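/- A Hamiltonian on $n$ qubits is a Hermitian $2^n\times 2^n$ matrix $H$, here always with spectral norm $\|H\|_\infty\le 1$. A matrix is $k$-local if it is a linear combination of $n$-fold tensor products of Pauli matrices $I,X,Y,Z$, each with at most $k$ non-identity factors. Distance is measured in the normalized Frobenius norm $\|A\|_2=\sqrt{\mathrm{tr}(A^\dagger A)/2^n}$. There is a universal constant $C>0$ such that the following holds. Let $n,k\in\mathbb{N}$, $0\le\varepsilon_1<\varepsilon_2\le 1$ and $\delta\in(0,1)$. There is a non-adaptive quantum algorithm with query access to controlled forward and reverse time evolution $e^{-iHt}$, $e^{iHt}$ ($t\ge 0$) of an unknown $n$-qubit Hamiltonian $H$ (the sequence of queries, with their times and directions, is fixed in advance, independently of $H$ and of measurement outcomes; between queries the algorithm applies fixed unitaries on a finite-dimensional workspace, which it measures at the end) such that, for every $n$-qubit Hamiltonian $H$ with $\|H\|_\infty\le 1$: 1. if some $k$-local Hamiltonian $K$ satisfies $\|H-K\|_2\le\varepsilon_1$, then the algorithm accepts with probability at least $1-\delta$; 2. if $\|H-K\|_2\ge\varepsilon_2$ for every $k$-local Hamiltonian $K$, then the algorithm rejects with probability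 at least $1-\delta$. The algorithm makes at most $C\,\dfrac{\log(1/\delta)}{(\varepsilon_2-\varepsilon_1)^2}$ queries, and its total evolution time (the sum of the times of all queries, forward and reverse) is at most $C\,\dfrac{\log(1/\delta)}{\varepsilon_2-\varepsilon_1}$. -/

import Mathlib

open scoped Matrix Kronecker

namespace LocalityTesting

noncomputable section

/-- Computational basis labels of an `n`-qubit register. -/
abbrev Qubits (n : ℕ) : Type := Fin n → Fin 2

/-- Operators on `n` qubits: `2^n × 2^n` complex matrices. -/
abbrev QMat (n : ℕ) : Type := Matrix (Qubits n) (Qubits n) ℂ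

/-- Labels of the single-qubit Pauli matrices. -/
inductive Pauli
  | I
  | X
  | Y
  | Z
  deriving DecidableEq

instance : Fintype Pauli where
  elems := {.I, .X, .Y, .Z}
  complete := by intro P; cases P <;> decide

/-- The single-qubit Pauli matrices. -/
def Pauli.mat : Pauli → Matrix (Fin 2) (Fin 2) ℂ
  | .I => 1
  | .X => !![0, 1; 1, 0]
  | .Y => !![0, -Complex.I; Complex.I, 0]
  | .Z => !![1, 0; 0, -1]

/-- The `n`-fold tensor product `P 0 ⊗ ⋯ ⊗ P (n-1)` of Pauli matrices. -/
def pauliString {n : ℕ} (P : Fin n → Pauli) : QMat n :=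
  Matrix.of fun x y => ∏ i, (P i).mat (x i) (y i)

/-- The locality `|P|`: the number of non-identity tensor factors. -/
def weight {n : ℕ} (P : Fin n → Pauli) : ℕ :=
  (Finset.univ.filter fun i => P i ≠ Pauli.I).card

/-- `A` is `k`-local: it is a linear combination of Pauli strings of weight at most `k`. -/
def IsKLocal {n : ℕ} (k : ℕ) (A : QMat n) : Prop :=
  ∃ α : (Fin n → Pauli) → ℂ,
    (∀ P, k < weight P → α P = 0) ∧ A = ∑ P, α P • pauliString P

/-- The spectral norm (largest singular value). -/
def spectralNorm {n : ℕ} (A : QMat n) : ℝ :=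
  ‖Matrix.toEuclideanCLM (n := Qubits n) (𝕜 := ℂ) A‖

/-- The normalized Frobenius norm `√(tr(A† A) / 2^n)`. -/
def frobNorm {n : ℕ} (A : QMat n) : ℝ :=
  Real.sqrt ((Aᴴ * A).trace.re / 2 ^ n)

/-- `H` is within distance `ε` of some `k`-local Hamiltonian. -/
def CloseToKLocal {n : ℕ} (k : ℕ) (ε : ℝ) (H : QMat n) : Prop :=
  ∃ K : QMat n, K.IsHermitian ∧ IsKLocal k K ∧ frobNorm (H - K) ≤ ε

/-- `H` is at distance at least `ε` from every `k`-local Hamiltonian. -/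
def FarFromKLocal {n : ℕ} (k : ℕ) (ε : ℝ) (H : QMat n) : Prop :=
  ∀ K : QMat n, K.IsHermitian → IsKLocal k K → ε ≤ frobNorm (H - K)

/-- A query: a nonnegative evolution time together with a direction
(`reverse = false`: apply `e^{-iHt}`; `reverse = true`: apply its inverse `e^{iHt}`). -/
structure Query where
  time : ℝ
  time_nonneg : 0 ≤ time
  reverse : Bool

/-- The unitary `e^{-iHt}` or `e^{iHt}` that a query gives access to. -/
def Query.evolution {n : ℕ} (q : Query) (H : QMat n) : QMat n :=
  NormedSpace.exp
    (((if q.reverse then Complex.I else -Complex.I) * (q.time : ℂ)) • H)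

/-- The computational basis of the whole workspace: one control qubit, the `n`-qubit register on
which the Hamiltonian acts, and a finite-dimensional ancilla register. -/
abbrev Workspace (n : ℕ) (Anc : Type) : Type := Fin 2 × (Qubits n × Anc)

/-- Controlled application of `U` on the `n`-qubit register: `|0⟩⟨0| ⊗ 1 + |1⟩⟨1| ⊗ U ⊗ 1`.
(The plain application of `U` is obtained by keeping the control qubit in the state `|1⟩`.) -/
def controlled {n : ℕ} (Anc : Type) [DecidableEq Anc] (U : QMat n) :
    Matrix (Workspace n Anc) (Workspace n Anc) ℂ :=
  Matrix.single 0 0 (1 : ℂ) ⊗ₖ (1 : Matrix (Qubits n × Anc) (Qubits n × Anc) ℂ) +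
    Matrix.single 1 1 (1 : ℂ) ⊗ₖ (U ⊗ₖ (1 : Matrix Anc Anc ℂ))

/-- A non-adaptive quantum algorithm with (controlled) access to forward and reverse time evolution
of an unknown `n`-qubit Hamiltonian: it starts in a fixed pure state, alternates queries with fixed
unitaries, and finally measures the workspace in the computational basis, accepting on a fixed set
of outcomes. Everything here, in particular the whole list of queries with their times and
directions, is fixed in advance: nothing depends on the Hamiltonian or on measurement outcomes. -/
structure NonadaptiveAlgorithm (n : ℕ) where
  Anc : Type
  [fintypeAnc : Fintype Anc]
  [decEqAnc : DecidableEq Anc]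
  /-- the initial state -/
  init : Workspace n Anc → ℂ
  init_unit : ∑ w, ‖init w‖ ^ 2 = 1
  /-- the successive queries, each with the unitary applied right after it -/
  steps : List (Query × Matrix.unitaryGroup (Workspace n Anc) ℂ)
  /-- the accepting measurement outcomes -/
  accept : Finset (Workspace n Anc)

attribute [instance] NonadaptiveAlgorithm.fintypeAnc NonadaptiveAlgorithm.decEqAnc

namespace NonadaptiveAlgorithm

variable {n : ℕ}

/-- The final state of the algorithm when the unknown Hamiltonian is `H`. -/
def finalState (T : NonadaptiveAlgorithm n) (H : QMat n) : Workspace n T.Anc → ℂ :=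
  T.steps.foldl
    (fun ψ s => (s.2 : Matrix (Workspace n T.Anc) (Workspace n T.Anc) ℂ) *ᵥ
      (controlled T.Anc (s.1.evolution H) *ᵥ ψ))
    T.init

/-- The probability that the final measurement accepts. -/
def acceptProb (T : NonadaptiveAlgorithm n) (H : QMat n) : ℝ :=
  ∑ w ∈ T.accept, ‖T.finalState H w‖ ^ 2

/-- The probability that the final measurement rejects. -/
def rejectProb (T : NonadaptiveAlgorithm n) (H : QMat n) : ℝ :=
  ∑ w ∈ T.acceptᶜ, ‖T.finalState H w‖ ^ 2

/-- The number of queries. -/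
def numQueries (T : NonadaptiveAlgorithm n) : ℕ := T.steps.length

/-- The total evolution time, over forward and reverse queries. -/
def totalTime (T : NonadaptiveAlgorithm n) : ℝ := (T.steps.map fun s => s.1.time).sum

/-- `T` tests, with success probability at least `1 - δ`, whether a Hamiltonian of spectral norm at
most `1` is `ε₁`-close to some `k`-local Hamiltonian or `ε₂`-far from all of them. -/
def IsTolerantLocalityTester (T : NonadaptiveAlgorithm n) (k : ℕ) (ε₁ ε₂ δ : ℝ) : Prop :=
  ∀ H : QMat n, H.IsHermitian → spectralNorm H ≤ 1 →
    (CloseToKLocal k ε₁ H → 1 - δ ≤ T.acceptProb H) ∧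
    (FarFromKLocal k ε₂ H → 1 - δ ≤ T.rejectProb H)

end NonadaptiveAlgorithm

end

end LocalityTesting

/-!
The distance of a Hamiltonian `H` from the `k`-local ones is the Euclidean norm of its Pauli
coefficients at strings of weight more than `k`, because the Pauli strings are an orthonormal basis
for the normalized trace inner product and the truncation of a Hermitian matrix is Hermitian
(`norm_highWeight_le_of_close`, `le_norm_highWeight_of_far`). For the short time `t = (ε₂ - ε₁) / 4`
the evolution is `e^{-iHt} = 1 - iHt + O(t²)`, and the identity is `k`-local. So the norm `a` of the
high-weight part of `e^{-iHt}` is `t` times the distance up to `t²`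
(`abs_norm_highWeight_exp_sub_le`), and it suffices to decide between `a ≤ a₁` and `a₂ ≤ a` for
amplitudes with a gap `g` of order `(ε₂ - ε₁)²`. Amplitude estimation does this with `O(1 / g)`
queries of time `t` each, and `O(log (1 / δ))` repetitions bring the error below `δ`.

Amplitude estimation takes the following form. Applied to half of a maximally entangled state `Φ`,
the evolution `U` produces a state whose component on the heavy Pauli strings has norm `a`. The walk
`G` composes the reflection at those strings, conjugated by `U`, with the reflection about `Φ`; it
costs one forward and one reverse query, and it satisfies `G²Φ + Φ = 2λ GΦ` with `λ = 2a² - 1`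
(`hasPhaseCos_walk`). This identity replaces the decomposition into eigenvectors with phases `±φ`,
`cos φ = λ`, and needs no case distinction when they coincide. A register with `M` values,
prepared in a sine window, controls the power of `G`, and is measured in the eigenbasis of half the
adjacency matrix of a path. The resulting state is an approximate eigenvector of this matrix for the
eigenvalue `λ`, which bounds the mean squared deviation of the outcome from `λ`
(`HasPhaseCos.sum_sq_mul_norm_phaseKraus_sq_le`). A register outcome acts on the system by a
polynomial in `G`, which preserves the identity above. Hence `r` registers can be used one after
the other on the same system, and the error of the majority vote is at most `2^{-r}`
(`HasPhaseCos.sum_norm_registerAmp_sq_le`). As all registers control powers of the same walk, only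
the sum of their values matters, and the algorithm is a single loop of identical queries.

When `δ ≥ 1 / 2` the allowed number of queries may be less than one; then a coin flip suffices.
-/

namespace LocalityTesting

noncomputable section

/-! ### Pauli expansions and the weight above the locality threshold -/

theorem sum_prod_pi {n : ℕ} {κ R : Type*} [Fintype κ] [CommSemiring R] (f : Fin n → κ → R) :
    ∑ x : Fin n → κ, ∏ i, f i (x i) = ∏ i, ∑ a, f i a := by
  classical
  rw [Finset.prod_univ_sum]
  simp

theorem Pauli.sum_univ {R : Type*} [AddCommMonoid R] (f : Pauli → R) :
    ∑ P, f P = f .I + (f .X + (f .Y + f .Z)) := by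
  have h : (Finset.univ : Finset Pauli) = {.I, .X, .Y, .Z} := rfl
  rw [h, Finset.sum_insert (by decide), Finset.sum_insert (by decide),
    Finset.sum_insert (by decide), Finset.sum_singleton]

theorem Pauli.sum_mat_mul_star (a b c d : Fin 2) :
    ∑ P : Pauli, P.mat a b * star (P.mat c d) = (if a = c then 1 else 0) * if b = d then 2 else 0 := by
  rw [Pauli.sum_univ]
  fin_cases a <;> fin_cases b <;> fin_cases c <;> fin_cases d <;>
    simp [Pauli.mat] <;> norm_num

theorem Pauli.sum_star_mat_mul (P Q : Pauli) :
    ∑ a, ∑ b, star (P.mat a b) * Q.mat a b = if P = Q then 2 else 0 := by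
  cases P <;> cases Q <;> simp [Pauli.mat, Fin.sum_univ_two] <;> norm_num

theorem Pauli.isHermitian_mat (P : Pauli) (a b : Fin 2) : star (P.mat a b) = P.mat b a := by
  cases P <;> fin_cases a <;> fin_cases b <;> simp [Pauli.mat]

variable {n : ℕ}

theorem star_pauliString (P : Fin n → Pauli) (x y : Qubits n) :
    star (pauliString P x y) = pauliString P y x := by
  simp only [pauliString, Matrix.of_apply, star_prod, Pauli.isHermitian_mat]

/-- Completeness of the Pauli strings: they are a basis of the space of all operators. -/
theorem sum_pauliString_mul_star (x y x' y' : Qubits n) :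
    ∑ P : Fin n → Pauli, pauliString P x y * star (pauliString P x' y') =
      (if x = x' then 1 else 0) * if y = y' then 2 ^ n else 0 := by
  simp only [pauliString, Matrix.of_apply, star_prod, ← Finset.prod_mul_distrib]
  rw [sum_prod_pi (fun i (P : Pauli) => P.mat (x i) (y i) * star (P.mat (x' i) (y' i)))]
  simp only [Pauli.sum_mat_mul_star, Finset.prod_mul_distrib]
  congr 1
  · by_cases h : x = x'
    · simp [h]
    · obtain ⟨i, hi⟩ := Function.ne_iff.mp h
      rw [if_neg h]
      exact Finset.prod_eq_zero (Finset.mem_univ i) (if_neg hi)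
  · by_cases h : y = y'
    · simp [h]
    · obtain ⟨i, hi⟩ := Function.ne_iff.mp h
      rw [if_neg h]
      exact Finset.prod_eq_zero (Finset.mem_univ i) (if_neg hi)

theorem sum_star_pauliString_mul (P Q : Fin n → Pauli) :
    ∑ x, ∑ y, star (pauliString P x y) * pauliString Q x y = if P = Q then 2 ^ n else 0 := by
  simp only [pauliString, Matrix.of_apply, star_prod, ← Finset.prod_mul_distrib]
  have h (x : Qubits n) := sum_prod_pi
    (fun i (b : Fin 2) => star ((P i).mat (x i) b) * (Q i).mat (x i) b)
  simp only [h]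
  rw [sum_prod_pi (fun i (a : Fin 2) => ∑ b, star ((P i).mat a b) * (Q i).mat a b)]
  simp only [Pauli.sum_star_mat_mul]
  by_cases h : P = Q
  · simp [h]
  · obtain ⟨i, hi⟩ := Function.ne_iff.mp h
    rw [if_neg h]
    exact Finset.prod_eq_zero (Finset.mem_univ i) (if_neg hi)

/-- The coefficient `tr(P† A) / 2^n` of `A` at a Pauli string. -/
def pauliCoeff (P : Fin n → Pauli) : QMat n →ₗ[ℂ] ℂ where
  toFun A := (∑ x, ∑ y, star (pauliString P x y) * A x y) / 2 ^ n
  map_add' A B := by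
    simp only [Matrix.add_apply, mul_add, Finset.sum_add_distrib, add_div]
  map_smul' c A := by
    simp only [Matrix.smul_apply, smul_eq_mul, RingHom.id_apply, Finset.mul_sum, Finset.sum_div]
    refine Finset.sum_congr rfl fun x _ => Finset.sum_congr rfl fun y _ => ?_
    ring

theorem pauliCoeff_apply (P : Fin n → Pauli) (A : QMat n) :
    pauliCoeff P A = (∑ x, ∑ y, star (pauliString P x y) * A x y) / 2 ^ n := rfl

theorem pauliCoeff_pauliString (P Q : Fin n → Pauli) :
    pauliCoeff P (pauliString Q) = if P = Q then 1 else 0 := by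
  rw [pauliCoeff_apply, sum_star_pauliString_mul]
  split_ifs <;> simp

theorem sum_pauliCoeff_smul (A : QMat n) : ∑ P, pauliCoeff P A • pauliString P = A := by
  ext x y
  have h (P : Fin n → Pauli) : pauliCoeff P A * pauliString P x y =
      (∑ x', ∑ y', pauliString P x y * star (pauliString P x' y') * A x' y') / 2 ^ n := by
    rw [pauliCoeff_apply, div_mul_eq_mul_div, Finset.sum_mul]
    congr 1
    refine Finset.sum_congr rfl fun x' _ => ?_
    rw [Finset.sum_mul]
    exact Finset.sum_congr rfl fun y' _ => by ring
  simp only [Matrix.sum_apply, Matrix.smul_apply, smul_eq_mul, h]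
  rw [← Finset.sum_div, Finset.sum_comm]
  have h2 (x' : Qubits n) : ∑ P : Fin n → Pauli, ∑ y', pauliString P x y *
      star (pauliString P x' y') * A x' y' = ∑ y', ((if x = x' then 1 else 0) *
        if y = y' then 2 ^ n else 0) * A x' y' := by
    rw [Finset.sum_comm]
    exact Finset.sum_congr rfl fun y' _ => by
      rw [← Finset.sum_mul, sum_pauliString_mul_star]
  rw [Finset.sum_congr rfl fun x' _ => h2 x']
  simp

theorem star_pauliCoeff_of_isHermitian {A : QMat n} (hA : A.IsHermitian) (P : Fin n → Pauli) :
    star (pauliCoeff P A) = pauliCoeff P A := by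
  rw [pauliCoeff_apply, star_div₀, star_sum, Finset.sum_congr rfl fun x _ => star_sum _ _,
    Finset.sum_comm]
  congr 1
  · refine Finset.sum_congr rfl fun y _ => Finset.sum_congr rfl fun x _ => ?_
    rw [star_mul', star_star, hA.apply, star_pauliString]
  · simp

theorem frobNorm_sq (A : QMat n) : frobNorm A ^ 2 = (∑ x, ∑ y, ‖A x y‖ ^ 2) / 2 ^ n := by
  have h : (Aᴴ * A).trace = ((∑ x, ∑ y, ‖A x y‖ ^ 2 : ℝ) : ℂ) := by
    simp only [Matrix.trace, Matrix.diag_apply, Matrix.mul_apply, Matrix.conjTranspose_apply]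
    rw [Finset.sum_comm]
    push_cast
    exact Finset.sum_congr rfl fun x _ => Finset.sum_congr rfl fun y _ => Complex.conj_mul' _
  rw [frobNorm, h, Complex.ofReal_re, Real.sq_sqrt (by positivity)]

theorem frobNorm_nonneg (A : QMat n) : 0 ≤ frobNorm A := Real.sqrt_nonneg _

/-- Parseval's identity for the Pauli expansion. -/
theorem sum_norm_pauliCoeff_sq (A : QMat n) : ∑ P, ‖pauliCoeff P A‖ ^ 2 = frobNorm A ^ 2 := by
  have key : ∑ P, star (pauliCoeff P A) * pauliCoeff P A =
      (∑ x, ∑ y, star (A x y) * A x y) / 2 ^ n := by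
    have h1 (P : Fin n → Pauli) : star (pauliCoeff P A) * pauliCoeff P A =
        (∑ x, ∑ y, star (A x y) * (pauliCoeff P A * pauliString P x y)) / 2 ^ n := by
      nth_rw 1 [pauliCoeff_apply]
      rw [star_div₀, star_sum, Finset.sum_congr rfl fun x _ => star_sum _ _, div_mul_eq_mul_div,
        Finset.sum_mul]
      congr 1
      · refine Finset.sum_congr rfl fun x _ => ?_
        rw [Finset.sum_mul]
        refine Finset.sum_congr rfl fun y _ => ?_
        rw [star_mul', star_star]
        ring
      · simp
    simp only [h1]
    rw [← Finset.sum_div, Finset.sum_comm]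
    congr 1
    refine Finset.sum_congr rfl fun x _ => ?_
    rw [Finset.sum_comm]
    refine Finset.sum_congr rfl fun y _ => ?_
    rw [← Finset.mul_sum]
    congr 1
    conv_rhs => rw [← sum_pauliCoeff_smul A]
    simp [Matrix.sum_apply]
  rw [frobNorm_sq]
  apply Complex.ofReal_injective
  push_cast
  simp only [← Complex.conj_mul']
  exact key

/-- The vector of the Pauli coefficients of an operator at the strings of weight more than `k`. Its
Euclidean norm is the distance of the operator from the `k`-local ones. -/
def highWeight (k : ℕ) : QMat n →ₗ[ℂ] EuclideanSpace ℂ (Fin n → Pauli) where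
  toFun A := WithLp.toLp 2 fun P => if k < weight P then pauliCoeff P A else 0
  map_add' A B := by
    ext P
    by_cases h : k < weight P <;> simp [h]
  map_smul' c A := by
    ext P
    by_cases h : k < weight P <;> simp [h]

theorem highWeight_apply (k : ℕ) (A : QMat n) (P : Fin n → Pauli) :
    highWeight k A P = if k < weight P then pauliCoeff P A else 0 := rfl

theorem norm_highWeight_le (k : ℕ) (A : QMat n) : ‖highWeight k A‖ ≤ frobNorm A := by
  refine le_of_sq_le_sq ?_ (frobNorm_nonneg A)
  rw [← sum_norm_pauliCoeff_sq, EuclideanSpace.norm_sq_eq]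
  refine Finset.sum_le_sum fun P _ => ?_
  rw [highWeight_apply]
  split_ifs
  · exact le_rfl
  · simp

theorem highWeight_eq_zero_of_isKLocal {k : ℕ} {A : QMat n} (hA : IsKLocal k A) :
    highWeight k A = 0 := by
  obtain ⟨α, hα, rfl⟩ := hA
  ext P
  rw [highWeight_apply]
  split_ifs with h
  · simp [pauliCoeff_pauliString, hα P h]
  · rfl

theorem pauliString_I : pauliString (fun _ : Fin n => Pauli.I) = 1 := by
  ext x y
  simp only [pauliString, Matrix.of_apply, Pauli.mat, Matrix.one_apply]
  by_cases h : x = y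
  · simp [h]
  · obtain ⟨i, hi⟩ := Function.ne_iff.mp h
    rw [if_neg h]
    exact Finset.prod_eq_zero (Finset.mem_univ i) (if_neg hi)

theorem isKLocal_one (k : ℕ) : IsKLocal k (1 : QMat n) := by
  refine ⟨fun P => if P = fun _ => Pauli.I then 1 else 0, fun P hP => if_neg ?_, ?_⟩
  · rintro rfl
    simp [weight] at hP
  · simp [pauliString_I]

theorem norm_highWeight_le_of_close {k : ℕ} {ε : ℝ} {H : QMat n} (h : CloseToKLocal k ε H) :
    ‖highWeight k H‖ ≤ ε := by
  obtain ⟨K, -, hK, hd⟩ := h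
  have h1 : highWeight k H = highWeight k (H - K) := by
    rw [map_sub, highWeight_eq_zero_of_isKLocal hK, sub_zero]
  rw [h1]
  exact (norm_highWeight_le k _).trans hd

/-- Truncating the Pauli expansion of `H` at weight `k` gives a `k`-local Hamiltonian whose
distance from `H` is the norm of the discarded coefficients. -/
theorem le_norm_highWeight_of_far {k : ℕ} {ε : ℝ} {H : QMat n} (hH : H.IsHermitian)
    (h : FarFromKLocal k ε H) : ε ≤ ‖highWeight k H‖ := by
  set K : QMat n := ∑ P, (if k < weight P then 0 else pauliCoeff P H) • pauliString P with hK
  have hHerm : K.IsHermitian := by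
    ext x y
    rw [Matrix.conjTranspose_apply, hK, Matrix.sum_apply, Matrix.sum_apply, star_sum]
    refine Finset.sum_congr rfl fun P _ => ?_
    rw [Matrix.smul_apply, Matrix.smul_apply, smul_eq_mul, smul_eq_mul, star_mul',
      star_pauliString]
    split_ifs
    · simp
    · rw [star_pauliCoeff_of_isHermitian hH]
  refine (h K hHerm ⟨_, fun P hP => if_pos hP, rfl⟩).trans ?_
  refine le_of_sq_le_sq ?_ (norm_nonneg _)
  rw [← sum_norm_pauliCoeff_sq, EuclideanSpace.norm_sq_eq]
  refine Finset.sum_le_sum fun P _ => ?_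
  have hc : pauliCoeff P K = if k < weight P then 0 else pauliCoeff P H := by
    simp only [hK, map_sum, map_smul, pauliCoeff_pauliString]
    simp
  rw [highWeight_apply, map_sub, hc]
  split_ifs <;> simp

/-! ### Short time evolution -/

/-- The second-order remainder of the exponential series in a Banach algebra. -/
theorem norm_exp_sub_one_sub_le {𝔸 : Type*} [NormedRing 𝔸] [NormedAlgebra ℂ 𝔸] [CompleteSpace 𝔸]
    (x : 𝔸) (hx : ‖x‖ ≤ 1) : ‖NormedSpace.exp x - 1 - x‖ ≤ ‖x‖ ^ 2 := by
  have hs : HasSum (fun m : ℕ => ((m.factorial : ℂ)⁻¹) • x ^ m) (NormedSpace.exp x) :=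
    NormedSpace.exp_series_hasSum_exp' x
  have hr : HasSum (fun m : ℕ => ((m.factorial : ℝ)⁻¹) • ‖x‖ ^ m) (NormedSpace.exp ‖x‖) :=
    NormedSpace.exp_series_hasSum_exp' (𝕂 := ℝ) ‖x‖
  rw [← hasSum_nat_add_iff' 2] at hs hr
  have h0 : NormedSpace.exp x - 1 - x =
      NormedSpace.exp x - ∑ i ∈ Finset.range 2, ((i.factorial : ℂ)⁻¹) • x ^ i := by
    simp [Finset.sum_range_succ, sub_sub]
  have hle : ‖NormedSpace.exp x - 1 - x‖ ≤ Real.exp ‖x‖ - 1 - ‖x‖ := by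
    rw [h0]
    refine (hs.norm_le_of_bounded hr fun i => ?_).trans (le_of_eq ?_)
    · rw [norm_smul, smul_eq_mul]
      refine mul_le_mul ?_ (norm_pow_le' x (by omega)) (by positivity) (by positivity)
      simp
    · simp [Finset.sum_range_succ, sub_sub, Real.exp_eq_exp_ℝ]
  refine hle.trans ((le_abs_self _).trans ?_)
  exact Real.abs_exp_sub_one_sub_id_le (by rwa [abs_of_nonneg (norm_nonneg x)])

theorem frobNorm_le_spectralNorm (A : QMat n) : frobNorm A ≤ spectralNorm A := by
  refine le_of_sq_le_sq ?_ (norm_nonneg _)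
  rw [frobNorm_sq, div_le_iff₀ (by positivity), Finset.sum_comm]
  have hcol (y : Qubits n) : ∑ x, ‖A x y‖ ^ 2 ≤ spectralNorm A ^ 2 := by
    have h := (Matrix.toEuclideanCLM (n := Qubits n) (𝕜 := ℂ) A).le_opNorm
      (EuclideanSpace.single y 1)
    rw [PiLp.norm_single, norm_one, mul_one] at h
    have h2 := pow_le_pow_left₀ (norm_nonneg _) h 2
    rw [EuclideanSpace.norm_sq_eq] at h2
    simpa [spectralNorm, Matrix.ofLp_toEuclideanCLM] using h2
  refine (Finset.sum_le_sum fun y _ => hcol y).trans (le_of_eq ?_)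
  simp [mul_comm]

theorem spectralNorm_exp_sub_one_sub_le (A : QMat n) (hA : spectralNorm A ≤ 1) :
    spectralNorm (NormedSpace.exp A - 1 - A) ≤ spectralNorm A ^ 2 := by
  open scoped Matrix.Norms.L2Operator in
  exact norm_exp_sub_one_sub_le A hA

/-- To first order in `t` the high-weight part of `e^{-iHt}` is `t` times that of `H`: the
zeroth-order term of the expansion is the identity, which is `k`-local. -/
theorem abs_norm_highWeight_exp_sub_le (k : ℕ) {H : QMat n} (hH : spectralNorm H ≤ 1) {t : ℝ}
    (ht0 : 0 ≤ t) (ht1 : t ≤ 1) :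
    |‖highWeight k (NormedSpace.exp ((-Complex.I * (t : ℂ)) • H))‖ - t * ‖highWeight k H‖| ≤
      t ^ 2 := by
  set A : QMat n := (-Complex.I * (t : ℂ)) • H with hA
  have hc : ‖-Complex.I * (t : ℂ)‖ = t := by simp [abs_of_nonneg ht0]
  have hAn : spectralNorm A ≤ t := by
    rw [spectralNorm, hA, map_smul, norm_smul, hc]
    exact mul_le_of_le_one_right ht0 hH
  have hR : ‖highWeight k (NormedSpace.exp A - 1 - A)‖ ≤ t ^ 2 :=
    (norm_highWeight_le k _).trans <| (frobNorm_le_spectralNorm _).trans <|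
      (spectralNorm_exp_sub_one_sub_le A (hAn.trans ht1)).trans <|
        pow_le_pow_left₀ (norm_nonneg _) hAn 2
  have hA2 : t * ‖highWeight k H‖ = ‖highWeight k A‖ := by
    rw [hA, map_smul, norm_smul, hc]
  rw [map_sub, map_sub, highWeight_eq_zero_of_isKLocal (isKLocal_one k), sub_zero] at hR
  rw [hA2]
  exact (abs_norm_sub_norm_le _ _).trans hR

theorem Query.evolution_reverse (t : ℝ) (ht : 0 ≤ t) {H : QMat n} (hH : H.IsHermitian) :
    Query.evolution ⟨t, ht, true⟩ H = (Query.evolution ⟨t, ht, false⟩ H)ᴴ := by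
  simp [Query.evolution, ← Matrix.exp_conjTranspose, hH.eq]

theorem Query.evolution_mem_unitaryGroup (t : ℝ) (ht : 0 ≤ t) {H : QMat n} (hH : H.IsHermitian) :
    Query.evolution ⟨t, ht, false⟩ H ∈ Matrix.unitaryGroup (Qubits n) ℂ := by
  rw [Matrix.mem_unitaryGroup_iff, Matrix.star_eq_conjTranspose, ← evolution_reverse t ht hH]
  simp only [Query.evolution, Bool.false_eq_true, if_false, if_true]
  set A : QMat n := (-Complex.I * (t : ℂ)) • H with hA
  have h2 : (Complex.I * (t : ℂ)) • H = -A := by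
    rw [hA, ← neg_smul]
    congr 1
    ring
  have hcomm : Commute A (-A) := (Commute.refl A).neg_right
  rw [h2, ← Matrix.exp_add_of_commute _ _ hcomm, add_neg_cancel, NormedSpace.exp_zero]

/-! ### The phase register: path matrix and sine window -/

/-- Half the adjacency matrix of the path with `M` vertices. Measuring its eigenvalue on a register
that controls the number of applications of `G` estimates the cosine of an eigenphase of `G`. -/
def pathMatrix (M : ℕ) : Matrix (Fin M) (Fin M) ℂ :=
  Matrix.of fun m m' =>
    (if m.1 + 1 = m'.1 then 1 / 2 else 0) + (if m'.1 + 1 = m.1 then 1 / 2 else 0)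

theorem isHermitian_pathMatrix (M : ℕ) : (pathMatrix M).IsHermitian := by
  ext m m'
  simp only [Matrix.conjTranspose_apply, pathMatrix, Matrix.of_apply, star_add]
  rw [add_comm]
  congr 1 <;> split_ifs <;> simp

/-- The unitary of eigenvectors of the path matrix. -/
def pathUnitary (M : ℕ) : Matrix.unitaryGroup (Fin M) ℂ :=
  (isHermitian_pathMatrix M).eigenvectorUnitary

/-- The eigenvalues of the path matrix. -/
def pathEigenvalue (M : ℕ) : Fin M → ℝ := (isHermitian_pathMatrix M).eigenvalues

theorem sum_pathUnitary_mul_pathMatrix (M : ℕ) (m j : Fin M) :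
    ∑ m', star ((pathUnitary M : Matrix _ _ ℂ) m' j) * pathMatrix M m' m =
      pathEigenvalue M j * star ((pathUnitary M : Matrix _ _ ℂ) m j) := by
  have h := (isHermitian_pathMatrix M).mulVec_eigenvectorBasis j
  have h2 := congrFun h m
  simp only [Matrix.mulVec, dotProduct, Pi.smul_apply] at h2
  have h3 := congrArg star h2
  rw [star_sum] at h3
  simp only [star_mul'] at h3
  have hA (m' : Fin M) : star (pathMatrix M m m') = pathMatrix M m' m :=
    (isHermitian_pathMatrix M).apply m' m
  simp only [hA] at h3
  simp only [pathUnitary, Matrix.IsHermitian.eigenvectorUnitary_apply, pathEigenvalue]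
  simp only [mul_comm _ (pathMatrix M _ m), h3]
  rw [Complex.real_smul, star_mul', Complex.star_def, Complex.conj_ofReal]

theorem sum_pathMatrix_smul {E : Type*} [AddCommGroup E] [Module ℂ E] {M : ℕ} (f : ℕ → E)
    (h0 : f 0 = 0) (hM : f (M + 1) = 0) (m : Fin M) :
    ∑ m', pathMatrix M m m' • f (m' + 1) = (1 / 2 : ℂ) • (f m + f (m + 2)) := by
  simp only [pathMatrix, Matrix.of_apply, add_smul, Finset.sum_add_distrib, ite_smul, zero_smul]
  rw [smul_add, add_comm]
  congr 1
  · rw [Fin.sum_univ_eq_sum_range (fun k => if k + 1 = m.1 then (1 / 2 : ℂ) • f (k + 1) else 0)]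
    rcases Nat.eq_zero_or_pos m.1 with h | h
    · simp [h, h0]
    · obtain ⟨k, hk⟩ := Nat.exists_eq_add_of_lt h
      have hk' : m.1 = k + 1 := by omega
      have : k < M := by omega
      simp [hk', this]
  · rw [Fin.sum_univ_eq_sum_range (fun k => if m.1 + 1 = k then (1 / 2 : ℂ) • f (k + 1) else 0)]
    rw [Finset.sum_ite_eq]
    split_ifs with h
    · rfl
    · have : m.1 + 2 = M + 1 := by simp at h; omega
      simp [this, hM]

theorem sum_cos_two_pi_mul_div (N : ℕ) (hN : 2 ≤ N) :
    ∑ k ∈ Finset.range N, Real.cos (2 * (Real.pi * k / N)) = 0 := by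
  have h := (Complex.isPrimitiveRoot_exp N (by omega)).geom_sum_eq_zero (by omega)
  have h2 := congrArg Complex.re h
  rw [Complex.re_sum, Complex.zero_re] at h2
  rw [← h2]
  refine Finset.sum_congr rfl fun k _ => ?_
  rw [← Complex.exp_nat_mul, ← Complex.exp_ofReal_mul_I_re]
  congr 2
  push_cast
  ring

/-- The sine window `√(2/N) sin(πk/N)`, normalized on the `N - 1` points `0 < k < N`. -/
def sineWindow (N k : ℕ) : ℝ := √(2 / N) * Real.sin (Real.pi * k / N)

/-- The cosine companion of the sine window. -/
def cosineWindow (N k : ℕ) : ℝ := √(2 / N) * Real.cos (Real.pi * k / N)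

theorem sineWindow_zero (N : ℕ) : sineWindow N 0 = 0 := by simp [sineWindow]

theorem sineWindow_self (N : ℕ) (hN : N ≠ 0) : sineWindow N N = 0 := by
  have : (N : ℝ) ≠ 0 := by exact_mod_cast hN
  simp [sineWindow, this]

theorem sum_sineWindow_sq (M : ℕ) (hM : 1 ≤ M) :
    ∑ m : Fin M, sineWindow (M + 1) (m + 1) ^ 2 = 1 := by
  rw [Fin.sum_univ_eq_sum_range (fun k => sineWindow (M + 1) (k + 1) ^ 2)]
  have h1 : ∑ k ∈ Finset.range (M + 1), sineWindow (M + 1) k ^ 2 = 1 := by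
    have hN : (0 : ℝ) < ((M + 1 : ℕ) : ℝ) := by positivity
    have h2 (k : ℕ) : sineWindow (M + 1) k ^ 2 = 1 / ((M + 1 : ℕ) : ℝ) *
        (1 - Real.cos (2 * (Real.pi * k / (M + 1 : ℕ)))) := by
      rw [sineWindow, mul_pow, Real.sq_sqrt (by positivity), Real.sin_sq_eq_half_sub]
      ring
    simp only [h2]
    rw [← Finset.mul_sum, Finset.sum_sub_distrib, sum_cos_two_pi_mul_div _ (by omega)]
    simp only [Finset.sum_const, Finset.card_range, nsmul_eq_mul]
    field_simp
    simp
  rw [Finset.sum_range_succ', sineWindow_zero] at h1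
  simpa using h1

theorem sum_cosineWindow_sq_le (M : ℕ) (hM : 1 ≤ M) :
    ∑ m : Fin M, cosineWindow (M + 1) (m + 1) ^ 2 ≤ 1 := by
  have h (m : Fin M) : cosineWindow (M + 1) (m + 1) ^ 2 =
      2 / ((M + 1 : ℕ) : ℝ) - sineWindow (M + 1) (m + 1) ^ 2 := by
    rw [sineWindow, cosineWindow, mul_pow, mul_pow, Real.sq_sqrt (by positivity), Real.cos_sq']
    ring
  simp only [h]
  rw [Finset.sum_sub_distrib, sum_sineWindow_sq M hM]
  simp only [Finset.sum_const, Finset.card_univ, Fintype.card_fin, nsmul_eq_mul]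
  have : (M : ℝ) * (2 / ((M + 1 : ℕ) : ℝ)) ≤ 2 := by
    rw [mul_div_assoc', div_le_iff₀ (by positivity)]
    push_cast
    linarith
  linarith

theorem sineWindow_shift (N k : ℕ) :
    sineWindow N k = Real.cos (Real.pi / N) * sineWindow N (k + 1) -
        Real.sin (Real.pi / N) * cosineWindow N (k + 1) ∧
      sineWindow N (k + 2) = Real.cos (Real.pi / N) * sineWindow N (k + 1) +
        Real.sin (Real.pi / N) * cosineWindow N (k + 1) := by
  have h1 : Real.pi * k / N = Real.pi * (k + 1 : ℕ) / N - Real.pi / N := by push_cast; ring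
  have h2 : Real.pi * (k + 2 : ℕ) / N = Real.pi * (k + 1 : ℕ) / N + Real.pi / N := by
    push_cast; ring
  constructor
  · rw [sineWindow, sineWindow, cosineWindow, h1, Real.sin_sub]
    ring
  · rw [sineWindow, sineWindow, cosineWindow, h2, Real.sin_add]
    ring

/-! ### Phase estimation on one register -/

variable {E : Type*} [NormedAddCommGroup E] [InnerProductSpace ℂ E]

/-- Parseval's identity for a change of orthonormal basis of a register entangled with `E`. -/
theorem sum_norm_sum_star_unitary_smul_sq {ι : Type*} [Fintype ι] [DecidableEq ι]
    (W : Matrix.unitaryGroup ι ℂ) (Ψ : ι → E) :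
    ∑ j, ‖∑ m, star ((W : Matrix ι ι ℂ) m j) • Ψ m‖ ^ 2 = ∑ m, ‖Ψ m‖ ^ 2 := by
  apply Complex.ofReal_injective
  push_cast
  simp only [← Complex.coe_algebraMap, ← inner_self_eq_norm_sq_to_K (𝕜 := ℂ)]
  have hW (m m' : ι) : ∑ j, (W : Matrix ι ι ℂ) m j * star ((W : Matrix ι ι ℂ) m' j) =
      if m = m' then 1 else 0 := by
    have := congrFun (congrFun (Matrix.mem_unitaryGroup_iff.mp W.2) m) m'
    simpa [Matrix.mul_apply, Matrix.one_apply] using this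
  have hexp (j : ι) : inner ℂ (∑ m, star ((W : Matrix ι ι ℂ) m j) • Ψ m)
      (∑ m, star ((W : Matrix ι ι ℂ) m j) • Ψ m) = ∑ m, ∑ m', (W : Matrix ι ι ℂ) m j *
        star ((W : Matrix ι ι ℂ) m' j) * inner ℂ (Ψ m) (Ψ m') := by
    rw [sum_inner]
    refine Finset.sum_congr rfl fun m _ => ?_
    rw [inner_sum]
    refine Finset.sum_congr rfl fun m' _ => ?_
    rw [inner_smul_left, inner_smul_right, Complex.star_def, Complex.conj_conj, mul_assoc]
  simp only [hexp]
  rw [Finset.sum_comm]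
  refine Finset.sum_congr rfl fun m _ => ?_
  rw [Finset.sum_comm]
  simp only [← Finset.sum_mul, hW]
  simp

/-- `χ` lies in a sum of eigenspaces of the isometry `G` whose eigenphases all have cosine `lam`. -/
def HasPhaseCos (G : E →ₗ[ℂ] E) (lam : ℝ) (χ : E) : Prop :=
  G (G χ) + χ = ((2 * lam : ℝ) : ℂ) • G χ

theorem HasPhaseCos.norm_combination_sq {G : E →ₗ[ℂ] E} (hG : ∀ x, ‖G x‖ = ‖x‖) {lam : ℝ} {χ : E}
    (h : HasPhaseCos G lam χ) (p q : ℝ) :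
    ‖(p : ℂ) • χ + (q : ℂ) • G χ‖ ^ 2 = (p ^ 2 + 2 * p * q * lam + q ^ 2) * ‖χ‖ ^ 2 := by
  have hin (x y : E) : inner ℂ (G x) (G y) = inner ℂ x y :=
    (⟨G, hG⟩ : E →ₗᵢ[ℂ] E).inner_map_map x y
  have hre : (inner ℂ χ (G χ)).re = lam * ‖χ‖ ^ 2 := by
    have h1 := congrArg (fun v => (inner ℂ (G χ) v).re) h
    simp only [inner_add_right, hin, inner_smul_right, Complex.add_re, Complex.re_ofReal_mul] at h1
    have h2 : (inner ℂ (G χ) χ).re = (inner ℂ χ (G χ)).re := inner_re_symm (𝕜 := ℂ) _ _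
    have h3 : (inner ℂ χ χ).re = ‖χ‖ ^ 2 := inner_self_eq_norm_sq (𝕜 := ℂ) χ
    rw [h2, h3] at h1
    linarith
  rw [norm_add_sq (𝕜 := ℂ), norm_smul, norm_smul, hG, inner_smul_left, inner_smul_right,
    Complex.conj_ofReal, mul_pow, mul_pow, Complex.norm_real, Complex.norm_real, Real.norm_eq_abs,
    Real.norm_eq_abs, sq_abs, sq_abs]
  have : RCLike.re ((p : ℂ) * ((q : ℂ) * inner ℂ χ (G χ))) = p * (q * (lam * ‖χ‖ ^ 2)) := by
    rw [← hre]
    exact (Complex.re_ofReal_mul _ _).trans (by rw [Complex.re_ofReal_mul])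
  rw [this]
  ring

theorem HasPhaseCos.sq_le_one {G : E →ₗ[ℂ] E} (hG : ∀ x, ‖G x‖ = ‖x‖) {lam : ℝ} {χ : E}
    (h : HasPhaseCos G lam χ) (h0 : χ ≠ 0) : lam ^ 2 ≤ 1 := by
  have h1 := h.norm_combination_sq hG (-lam) 1
  have h2 : 0 < ‖χ‖ ^ 2 := by positivity
  have h3 : 0 ≤ ((-lam) ^ 2 + 2 * (-lam) * 1 * lam + 1 ^ 2) * ‖χ‖ ^ 2 := h1 ▸ sq_nonneg _
  nlinarith [nonneg_of_mul_nonneg_left h3 h2]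

theorem norm_pow_apply {G : E →ₗ[ℂ] E} (hG : ∀ x, ‖G x‖ = ‖x‖) (m : ℕ) (x : E) :
    ‖(G ^ m) x‖ = ‖x‖ := by
  induction m with
  | zero => simp
  | succ m ih => rw [pow_succ', Module.End.mul_apply, hG, ih]

/-- The amplitude with which register outcome `j` is obtained from register value `m`. -/
def phaseWeight (M : ℕ) (j m : Fin M) : ℂ :=
  star ((pathUnitary M : Matrix _ _ ℂ) m j) * sineWindow (M + 1) (m + 1)

/-- The effect on the system of one run of phase estimation of `G` with outcome `j`: the register
is prepared in the window state, controls the power of `G`, and is measured in the eigenbasis of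
the path matrix. -/
def phaseKraus (G : E →ₗ[ℂ] E) (M : ℕ) (j : Fin M) : E →ₗ[ℂ] E :=
  ∑ m : Fin M, phaseWeight M j m • G ^ (m : ℕ)

theorem phaseKraus_apply (G : E →ₗ[ℂ] E) (M : ℕ) (j : Fin M) (χ : E) :
    phaseKraus G M j χ = ∑ m : Fin M, star ((pathUnitary M : Matrix _ _ ℂ) m j) •
      ((sineWindow (M + 1) (m + 1) : ℂ) • (G ^ (m : ℕ)) χ) := by
  simp [phaseKraus, phaseWeight, LinearMap.sum_apply, mul_smul]

theorem commute_phaseKraus (G : E →ₗ[ℂ] E) (M : ℕ) (j : Fin M) : Commute G (phaseKraus G M j) :=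
  Commute.sum_right _ _ _ fun m _ => ((Commute.refl G).pow_right m).smul_right _

theorem HasPhaseCos.map_phaseKraus {G : E →ₗ[ℂ] E} {lam : ℝ} {χ : E} (h : HasPhaseCos G lam χ)
    (M : ℕ) (j : Fin M) : HasPhaseCos G lam (phaseKraus G M j χ) := by
  have hc (x : E) : G (phaseKraus G M j x) =
      phaseKraus G M j (G x) :=
    LinearMap.congr_fun (commute_phaseKraus G M j).eq x
  rw [HasPhaseCos, hc, hc, ← map_add, h, map_smul]

theorem sum_norm_phaseKraus_sq {G : E →ₗ[ℂ] E} (hG : ∀ x, ‖G x‖ = ‖x‖) {M : ℕ} (hM : 1 ≤ M)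
    (χ : E) : ∑ j, ‖phaseKraus G M j χ‖ ^ 2 = ‖χ‖ ^ 2 := by
  simp only [phaseKraus_apply]
  rw [sum_norm_sum_star_unitary_smul_sq]
  simp only [norm_smul, norm_pow_apply hG, mul_pow, Complex.norm_real, Real.norm_eq_abs, sq_abs]
  rw [← Finset.sum_mul, sum_sineWindow_sq M hM, one_mul]

/-- The mean squared error of phase estimation. The window state with phases attached is an
approximate eigenvector of the path matrix: the error consists of the deviation of the top
eigenvalue `cos(π/N)` from `1`, and of the slope of the window times the sine of the phase. -/
theorem HasPhaseCos.sum_sq_mul_norm_phaseKraus_sq_le {G : E →ₗ[ℂ] E} (hG : ∀ x, ‖G x‖ = ‖x‖)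
    {lam : ℝ} {χ : E} (h : HasPhaseCos G lam χ) {M : ℕ} (hM : 1 ≤ M) :
    ∑ j, (pathEigenvalue M j - lam) ^ 2 * ‖phaseKraus G M j χ‖ ^ 2 ≤
      ((1 - Real.cos (Real.pi / (M + 1 : ℕ))) ^ 2 +
        Real.sin (Real.pi / (M + 1 : ℕ)) ^ 2 * (1 - lam ^ 2)) * ‖χ‖ ^ 2 := by
  rcases eq_or_ne χ 0 with rfl | hχ0
  · simp
  set κ := Real.cos (Real.pi / (M + 1 : ℕ))
  set s := Real.sin (Real.pi / (M + 1 : ℕ))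
  set F := sineWindow (M + 1) with hF
  set C := cosineWindow (M + 1) with hC
  set f : ℕ → E := fun k => (F k : ℂ) • (G ^ (k - 1)) χ with hf
  set Ψ : Fin M → E := fun m => (∑ m', pathMatrix M m m' • f (m' + 1)) - (lam : ℂ) • f (m + 1)
    with hΨ
  have hK (j : Fin M) : ((pathEigenvalue M j - lam : ℝ) : ℂ) • phaseKraus G M j χ =
      ∑ m, star ((pathUnitary M : Matrix _ _ ℂ) m j) • Ψ m := by
    simp only [hΨ, smul_sub, Finset.sum_sub_distrib, Finset.smul_sum]
    rw [Finset.sum_comm]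
    simp only [smul_smul, ← Finset.sum_smul, sum_pathUnitary_mul_pathMatrix]
    rw [phaseKraus_apply, Complex.ofReal_sub, sub_smul, Finset.smul_sum, Finset.smul_sum]
    congr 1
    · exact Finset.sum_congr rfl fun m _ => smul_smul _ _ _
    · refine Finset.sum_congr rfl fun m _ => ?_
      rw [smul_smul, mul_comm]
      rfl
  have hnorm (m : Fin M) : ‖Ψ m‖ ^ 2 =
      (lam ^ 2 * (1 - κ) ^ 2 * F (m + 1) ^ 2 + s ^ 2 * (1 - lam ^ 2) * C (m + 1) ^ 2) *
        ‖χ‖ ^ 2 := by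
    have h1 : Ψ m = (G ^ (m : ℕ)) (((lam * F m - lam * F (m + 1) : ℝ) : ℂ) • χ +
        (((F (m + 2) - F m) / 2 : ℝ) : ℂ) • G χ) := by
      have hfm : f m = (F m : ℂ) • (G ^ (m : ℕ)) (((2 * lam : ℝ) : ℂ) • χ - G χ) := by
        rcases Nat.eq_zero_or_pos m.1 with h0 | h0
        · simp [hf, hF, h0, sineWindow_zero]
        · have hG' : G (((2 * lam : ℝ) : ℂ) • χ - G χ) = χ := by
            rw [map_sub, map_smul, ← h, add_sub_cancel_left]
          obtain ⟨k, hk⟩ := Nat.exists_eq_add_of_lt h0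
          have hk' : m.1 = k + 1 := by omega
          simp only [hf]
          rw [hk', Nat.add_sub_cancel, pow_succ, Module.End.mul_apply, hG']
      have hf1 : f (m + 1) = (F (m + 1) : ℂ) • (G ^ (m : ℕ)) χ := rfl
      have hf2 : f (m + 2) = (F (m + 2) : ℂ) • (G ^ (m : ℕ)) (G χ) := by
        simp only [hf]
        rw [show m.1 + 2 - 1 = m.1 + 1 by omega, pow_succ, Module.End.mul_apply]
      simp only [hΨ]
      rw [sum_pathMatrix_smul f (by simp [hf, hF, sineWindow_zero])
        (by simp [hf, hF, sineWindow_self]), hfm, hf1, hf2]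
      simp only [map_add, map_sub, map_smul]
      push_cast
      module
    rw [h1, norm_pow_apply hG, h.norm_combination_sq hG]
    obtain ⟨e1, e2⟩ := sineWindow_shift (M + 1) m
    rw [hF, e1, e2]
    ring
  have hsum : ∑ j, (pathEigenvalue M j - lam) ^ 2 * ‖phaseKraus G M j χ‖ ^ 2 =
      (lam ^ 2 * (1 - κ) ^ 2 + s ^ 2 * (1 - lam ^ 2) * ∑ m : Fin M, C (m + 1) ^ 2) * ‖χ‖ ^ 2 := by
    have h1 (j : Fin M) : (pathEigenvalue M j - lam) ^ 2 *
        ‖phaseKraus G M j χ‖ ^ 2 =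
        ‖∑ m, star ((pathUnitary M : Matrix _ _ ℂ) m j) • Ψ m‖ ^ 2 := by
      rw [← hK, norm_smul, mul_pow, Complex.norm_real, Real.norm_eq_abs, sq_abs]
    simp only [h1]
    rw [sum_norm_sum_star_unitary_smul_sq]
    simp only [hnorm]
    rw [← Finset.sum_mul, Finset.sum_add_distrib, ← Finset.mul_sum, ← Finset.mul_sum,
      sum_sineWindow_sq M hM, mul_one]
  have hl := h.sq_le_one hG hχ0
  rw [hsum]
  refine mul_le_mul_of_nonneg_right (add_le_add ?_ ?_) (by positivity)
  · exact mul_le_of_le_one_left (sq_nonneg _) hl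
  · exact mul_le_of_le_one_right (mul_nonneg (sq_nonneg _) (by linarith))
      (sum_cosineWindow_sq_le M hM)

/-! ### Several registers and majority vote -/

/-- The unnormalized state of the system after `r` runs of phase estimation with outcomes `f`. -/
def registerAmp (G : E →ₗ[ℂ] E) (M r : ℕ) (f : Fin r → Fin M) (χ : E) : E :=
  ∑ m : Fin r → Fin M, (∏ i, phaseWeight M (f i) (m i)) • (G ^ (∑ i, (m i : ℕ))) χ

theorem registerAmp_cons (G : E →ₗ[ℂ] E) (M r : ℕ) (j : Fin M) (f : Fin r → Fin M) (χ : E) :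
    registerAmp G M (r + 1) (Fin.cons j f) χ = registerAmp G M r f (phaseKraus G M j χ) := by
  rw [registerAmp, ← (Fin.consEquiv fun _ => Fin M).sum_comp, Fintype.sum_prod_type,
    Finset.sum_comm, registerAmp]
  refine Finset.sum_congr rfl fun m _ => ?_
  simp only [phaseKraus, LinearMap.sum_apply, map_sum, Finset.smul_sum]
  refine Finset.sum_congr rfl fun m0 _ => ?_
  simp only [Fin.consEquiv_apply, Fin.prod_univ_succ, Fin.sum_univ_succ, Fin.cons_zero,
    Fin.cons_succ, LinearMap.smul_apply, map_smul, smul_smul]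
  rw [mul_comm, add_comm, pow_add, Module.End.mul_apply]

/-- A bound on the weighted outcome distribution of a single run, valid for all states of the
given phase, multiplies over the runs: each run leaves the system in a state of the same phase. -/
theorem HasPhaseCos.sum_prod_mul_norm_registerAmp_sq_le {G : E →ₗ[ℂ] E} {lam B : ℝ} {M : ℕ}
    {w : Fin M → ℝ} (hw : ∀ j, 0 ≤ w j) (hB0 : 0 ≤ B)
    (hB : ∀ χ, HasPhaseCos G lam χ → ∑ j, w j * ‖phaseKraus G M j χ‖ ^ 2 ≤
      B * ‖χ‖ ^ 2) (r : ℕ) (χ : E) (hχ : HasPhaseCos G lam χ) :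
    ∑ f : Fin r → Fin M, (∏ i, w (f i)) * ‖registerAmp G M r f χ‖ ^ 2 ≤ B ^ r * ‖χ‖ ^ 2 := by
  induction r generalizing χ with
  | zero => simp [registerAmp]
  | succ r ih =>
    have hc (j : Fin M) (f : Fin r → Fin M) : registerAmp G M (r + 1)
        (Fin.consEquiv (fun _ => Fin M) (j, f)) χ = registerAmp G M r f (phaseKraus G M j χ) :=
      registerAmp_cons G M r j f χ
    rw [← (Fin.consEquiv fun _ => Fin M).sum_comp, Fintype.sum_prod_type]
    simp only [hc]
    simp only [Fin.consEquiv_apply, Fin.prod_univ_succ, Fin.cons_zero, Fin.cons_succ,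
      mul_assoc, ← Finset.mul_sum]
    calc _ ≤ ∑ j, w j * (B ^ r * ‖phaseKraus G M j χ‖ ^ 2) :=
          Finset.sum_le_sum fun j _ => mul_le_mul_of_nonneg_left (ih _ (hχ.map_phaseKraus M j)) (hw j)
      _ = B ^ r * ∑ j, w j * ‖phaseKraus G M j χ‖ ^ 2 := by
          rw [Finset.mul_sum]
          exact Finset.sum_congr rfl fun j _ => by ring
      _ ≤ B ^ r * (B * ‖χ‖ ^ 2) := mul_le_mul_of_nonneg_left (hB χ hχ) (by positivity)
      _ = _ := by ring

/-- The number of runs whose estimate of the cosine of the phase lies below the threshold. -/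
def numBelow (M r : ℕ) (τ : ℝ) (f : Fin r → Fin M) : ℕ :=
  (Finset.univ.filter fun i => pathEigenvalue M (f i) < τ).card

/-- If the mean squared error is at most a sixteenth of the squared distance `γ²` from the phase to
a set of estimates, then at least half of the runs fall into that set with probability at most
`2^{-r}`. The proof bounds the moment generating function of the number of such runs at `16`. -/
theorem HasPhaseCos.sum_norm_registerAmp_sq_le {G : E →ₗ[ℂ] E} (hG : ∀ x, ‖G x‖ = ‖x‖)
    {lam γ : ℝ} {χ : E} (h : HasPhaseCos G lam χ) {M : ℕ} (hM : 1 ≤ M) (hγ : 0 < γ)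
    (hηγ : 16 * ((1 - Real.cos (Real.pi / (M + 1 : ℕ))) ^ 2 +
      Real.sin (Real.pi / (M + 1 : ℕ)) ^ 2 * (1 - lam ^ 2)) ≤ γ ^ 2)
    (bad : Fin M → Prop) [DecidablePred bad] (hbad : ∀ j, bad j → γ ≤ |pathEigenvalue M j - lam|)
    (r : ℕ) (S : Finset (Fin r → Fin M))
    (hS : ∀ f ∈ S, r ≤ 2 * (Finset.univ.filter fun i => bad (f i)).card) :
    ∑ f ∈ S, ‖registerAmp G M r f χ‖ ^ 2 ≤ (1 / 2) ^ r * ‖χ‖ ^ 2 := by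
  set w : Fin M → ℝ := fun j => if bad j then 16 else 1 with hw
  have hw1 (j : Fin M) : 1 ≤ w j := by
    simp only [hw]
    split_ifs <;> norm_num
  have hB (χ' : E) (hχ' : HasPhaseCos G lam χ') :
      ∑ j, w j * ‖phaseKraus G M j χ'‖ ^ 2 ≤ 2 * ‖χ'‖ ^ 2 := by
    have hwle (j : Fin M) : w j ≤ 1 + 15 / γ ^ 2 * (pathEigenvalue M j - lam) ^ 2 := by
      simp only [hw]
      split_ifs with hj
      · have h1 : γ ^ 2 ≤ (pathEigenvalue M j - lam) ^ 2 := by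
          rw [← sq_abs (pathEigenvalue M j - lam)]
          exact pow_le_pow_left₀ hγ.le (hbad j hj) 2
        have h2 : 15 ≤ 15 / γ ^ 2 * (pathEigenvalue M j - lam) ^ 2 := by
          rw [div_mul_eq_mul_div, le_div_iff₀ (by positivity)]
          linarith
        linarith
      · have : 0 ≤ 15 / γ ^ 2 * (pathEigenvalue M j - lam) ^ 2 := by positivity
        linarith
    have hmse := hχ'.sum_sq_mul_norm_phaseKraus_sq_le hG hM
    calc _ ≤ ∑ j, (1 + 15 / γ ^ 2 * (pathEigenvalue M j - lam) ^ 2) *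
            ‖phaseKraus G M j χ'‖ ^ 2 :=
          Finset.sum_le_sum fun j _ => mul_le_mul_of_nonneg_right (hwle j) (sq_nonneg _)
      _ = ‖χ'‖ ^ 2 + 15 / γ ^ 2 * ∑ j, (pathEigenvalue M j - lam) ^ 2 *
            ‖phaseKraus G M j χ'‖ ^ 2 := by
          simp only [add_mul, one_mul, Finset.sum_add_distrib, sum_norm_phaseKraus_sq hG hM,
            mul_assoc, ← Finset.mul_sum]
      _ ≤ ‖χ'‖ ^ 2 + 15 / γ ^ 2 * (γ ^ 2 / 16 * ‖χ'‖ ^ 2) := by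
          gcongr
          refine hmse.trans (mul_le_mul_of_nonneg_right ?_ (sq_nonneg _))
          linarith
      _ = 31 / 16 * ‖χ'‖ ^ 2 := by
          field_simp
          ring
      _ ≤ 2 * ‖χ'‖ ^ 2 := by
          gcongr
          norm_num
  have hmain := HasPhaseCos.sum_prod_mul_norm_registerAmp_sq_le
    (fun j => zero_le_one.trans (hw1 j)) zero_le_two hB r χ h
  have hprod (f : Fin r → Fin M) (hf : f ∈ S) : (4 : ℝ) ^ r ≤ ∏ i, w (f i) := by
    simp only [hw]
    rw [Finset.prod_ite, Finset.prod_const, Finset.prod_const_one, mul_one,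
      show (16 : ℝ) = 4 ^ 2 by norm_num, ← pow_mul]
    exact pow_le_pow_right₀ (by norm_num) (hS f hf)
  have hle : (4 : ℝ) ^ r * ∑ f ∈ S, ‖registerAmp G M r f χ‖ ^ 2 ≤ 2 ^ r * ‖χ‖ ^ 2 := by
    refine le_trans ?_ hmain
    rw [Finset.mul_sum]
    refine (Finset.sum_le_sum fun f hf =>
      mul_le_mul_of_nonneg_right (hprod f hf) (sq_nonneg _)).trans ?_
    refine Finset.sum_le_sum_of_subset_of_nonneg (Finset.subset_univ _) fun f _ _ => ?_
    exact mul_nonneg (Finset.prod_nonneg fun i _ => zero_le_one.trans (hw1 _)) (sq_nonneg _)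
  have h4 : (4 : ℝ) ^ r = 2 ^ r * 2 ^ r := by rw [← mul_pow]; norm_num
  rw [h4, mul_assoc] at hle
  have h5 := le_of_mul_le_mul_left hle (by positivity)
  rw [one_div, inv_pow, inv_mul_eq_div, le_div_iff₀ (by positivity), mul_comm]
  exact h5

/-! ### The Grover walk of the Hamiltonian evolution -/

theorem norm_toLpLin_of_mem_unitaryGroup {ι : Type*} [Fintype ι] [DecidableEq ι]
    {A : Matrix ι ι ℂ} (hA : A ∈ Matrix.unitaryGroup ι ℂ) (v : EuclideanSpace ℂ ι) :
    ‖Matrix.toLpLin 2 2 A v‖ = ‖v‖ := by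
  have h := sum_norm_sum_star_unitary_smul_sq (star (⟨A, hA⟩ : Matrix.unitaryGroup ι ℂ)) v.ofLp
  rw [← sq_eq_sq₀ (norm_nonneg _) (norm_nonneg _), EuclideanSpace.norm_sq_eq,
    EuclideanSpace.norm_sq_eq, ← h]
  refine Finset.sum_congr rfl fun j _ => ?_
  simp [Matrix.toLpLin_apply, Matrix.mulVec, dotProduct, Unitary.coe_star, Matrix.star_apply]

theorem toLpLin_toLp_eq {ι : Type*} [Fintype ι] [DecidableEq ι] (A : Matrix ι ι ℂ) (v : ι → ℂ) :
    Matrix.toLpLin 2 2 A (WithLp.toLp 2 v) = WithLp.toLp 2 (A *ᵥ v) := rfl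

theorem toLpLin_pow_toLp {ι : Type*} [Fintype ι] [DecidableEq ι] (A : Matrix ι ι ℂ) (m : ℕ)
    (v : ι → ℂ) :
    ((Matrix.toLpLin 2 2 A) ^ m) (WithLp.toLp 2 v) = WithLp.toLp 2 ((A ^ m) *ᵥ v) := by
  induction m with
  | zero => simp
  | succ m ih =>
    rw [pow_succ', Module.End.mul_apply, ih, toLpLin_toLp_eq, Matrix.mulVec_mulVec, pow_succ']

/-- Basis labels of the `n`-qubit register together with a reference register of equal size. -/
abbrev Sys (n : ℕ) : Type := Qubits n × Qubits n

/-- The Choi vector of an operator: the operator applied to half of a maximally entangled state. -/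
def choi (A : QMat n) : Sys n → ℂ := fun p => A p.1 p.2 / √(2 ^ n)

theorem ofReal_sqrt_two_pow_mul_self (n : ℕ) : ((√(2 ^ n) : ℝ) : ℂ) * (√(2 ^ n) : ℝ) = 2 ^ n := by
  rw [← Complex.ofReal_mul, Real.mul_self_sqrt (by positivity)]
  push_cast
  rfl

theorem star_choi_pauliString_dotProduct (P : Fin n → Pauli) (A : QMat n) :
    star (choi (pauliString P)) ⬝ᵥ choi A = pauliCoeff P A := by
  rw [pauliCoeff_apply, dotProduct, Fintype.sum_prod_type, Finset.sum_div]
  refine Finset.sum_congr rfl fun x _ => ?_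
  rw [Finset.sum_div]
  refine Finset.sum_congr rfl fun y _ => ?_
  rw [← ofReal_sqrt_two_pow_mul_self n]
  simp only [choi, Pi.star_apply, star_div₀, Complex.star_def, Complex.conj_ofReal]
  rw [div_mul_div_comm]

theorem kronecker_one_mulVec_choi_one (U : QMat n) :
    (U ⊗ₖ (1 : Matrix (Qubits n) (Qubits n) ℂ)) *ᵥ choi 1 = choi U := by
  ext ⟨x, y⟩
  simp only [Matrix.mulVec, dotProduct, Fintype.sum_prod_type, choi, Matrix.kroneckerMap_apply]
  simp [Matrix.one_apply, div_eq_mul_inv]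

/-- The orthogonal projection onto the span of the Choi vectors of a set of Pauli strings. -/
def pauliProj (S : Finset (Fin n → Pauli)) : Matrix (Sys n) (Sys n) ℂ :=
  ∑ P ∈ S, Matrix.vecMulVec (choi (pauliString P)) (star (choi (pauliString P)))

theorem pauliProj_mulVec_choi (S : Finset (Fin n → Pauli)) (A : QMat n) :
    pauliProj S *ᵥ choi A = ∑ P ∈ S, pauliCoeff P A • choi (pauliString P) := by
  rw [pauliProj, Matrix.sum_mulVec]
  refine Finset.sum_congr rfl fun P _ => ?_
  rw [Matrix.vecMulVec_mulVec, star_choi_pauliString_dotProduct]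
  ext p
  simp [mul_comm]

theorem pauliProj_mul_self (S : Finset (Fin n → Pauli)) : pauliProj S * pauliProj S = pauliProj S := by
  nth_rw 2 3 [pauliProj]
  rw [Finset.mul_sum]
  refine Finset.sum_congr rfl fun P hP => ?_
  rw [Matrix.mul_vecMulVec, pauliProj_mulVec_choi]
  congr 1
  simp [pauliCoeff_pauliString, hP]

theorem isHermitian_pauliProj (S : Finset (Fin n → Pauli)) : (pauliProj S).IsHermitian := by
  rw [Matrix.IsHermitian, pauliProj, Matrix.conjTranspose_sum]
  simp [Matrix.conjTranspose_vecMulVec]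

/-- The reflection that flips the sign of the span of the Choi vectors of a set of Pauli strings. -/
def pauliReflection (S : Finset (Fin n → Pauli)) : Matrix.unitaryGroup (Sys n) ℂ :=
  ⟨1 - (2 : ℂ) • pauliProj S, by
    rw [Matrix.mem_unitaryGroup_iff, Matrix.star_eq_conjTranspose, Matrix.conjTranspose_sub,
      Matrix.conjTranspose_one, Matrix.conjTranspose_smul, (isHermitian_pauliProj S).eq]
    simp only [Complex.star_def, Complex.conj_ofNat, mul_sub, sub_mul, mul_one, one_mul,
      smul_mul_assoc, mul_smul_comm, pauliProj_mul_self]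
    module⟩

theorem pauliReflection_mul_self (S : Finset (Fin n → Pauli)) :
    (pauliReflection S : Matrix (Sys n) (Sys n) ℂ) * (pauliReflection S).1 = 1 := by
  simp only [pauliReflection, mul_sub, sub_mul, mul_one, one_mul,
      smul_mul_assoc, mul_smul_comm, pauliProj_mul_self]
  module

/-- The Pauli strings of weight more than `k`. -/
def heavy (n k : ℕ) : Finset (Fin n → Pauli) := Finset.univ.filter fun P => k < weight P

/-- The identity string, whose Choi vector is the maximally entangled state. -/
def identityString (n : ℕ) : Finset (Fin n → Pauli) := {fun _ => Pauli.I}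

/-- The Grover walk of a unitary `U` for amplitude estimation of its heavy Pauli part: conjugate the
reflection about the heavy strings by `U`, and reflect about the maximally entangled state. -/
def walk (k : ℕ) (U : QMat n) : Matrix (Sys n) (Sys n) ℂ :=
  (pauliReflection (identityString n)).1 * ((U ⊗ₖ (1 : Matrix (Qubits n) (Qubits n) ℂ))ᴴ *
    ((pauliReflection (heavy n k)).1 * (U ⊗ₖ (1 : Matrix (Qubits n) (Qubits n) ℂ))))

theorem kronecker_one_mem_unitaryGroup {U : QMat n} (hU : U ∈ Matrix.unitaryGroup (Qubits n) ℂ) :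
    U ⊗ₖ (1 : Matrix (Qubits n) (Qubits n) ℂ) ∈ Matrix.unitaryGroup (Sys n) ℂ :=
  Matrix.kronecker_mem_unitary hU (one_mem _)

theorem walk_mem_unitaryGroup (k : ℕ) {U : QMat n} (hU : U ∈ Matrix.unitaryGroup (Qubits n) ℂ) :
    walk k U ∈ Matrix.unitaryGroup (Sys n) ℂ :=
  mul_mem (pauliReflection _).2 (mul_mem (Unitary.star_mem (kronecker_one_mem_unitaryGroup hU))
    (mul_mem (pauliReflection _).2 (kronecker_one_mem_unitaryGroup hU)))

theorem sum_heavy_norm_pauliCoeff_sq (k : ℕ) (A : QMat n) :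
    ∑ P ∈ heavy n k, star (pauliCoeff P A) * pauliCoeff P A = ((‖highWeight k A‖ ^ 2 : ℝ) : ℂ) := by
  rw [EuclideanSpace.norm_sq_eq, heavy, Finset.sum_filter]
  push_cast
  refine Finset.sum_congr rfl fun P _ => ?_
  rw [highWeight_apply]
  split_ifs
  · exact Complex.conj_mul' _
  · simp

/-- The maximally entangled state splits into eigenvectors of the walk, whose eigenphases have
cosine `2a² - 1` for `a` the norm of the heavy part of `U`. -/
theorem hasPhaseCos_walk (k : ℕ) {U : QMat n} (hU : U ∈ Matrix.unitaryGroup (Qubits n) ℂ) :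
    HasPhaseCos (Matrix.toLpLin 2 2 (walk k U)) (2 * ‖highWeight k U‖ ^ 2 - 1)
      (WithLp.toLp 2 (choi (1 : QMat n))) := by
  set V : Matrix (Sys n) (Sys n) ℂ := U ⊗ₖ (1 : Matrix (Qubits n) (Qubits n) ℂ) with hV
  have hVV : V * Vᴴ = 1 := Matrix.mem_unitaryGroup_iff.mp (kronecker_one_mem_unitaryGroup hU)
  have hVV' : Vᴴ * V = 1 := Matrix.mem_unitaryGroup_iff'.mp (kronecker_one_mem_unitaryGroup hU)
  set X := (pauliReflection (identityString n)).1 with hX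
  set Y := Vᴴ * ((pauliReflection (heavy n k)).1 * V) with hY
  set Φ := choi (1 : QMat n) with hΦ
  set a := ‖highWeight k U‖ with ha
  have hXX : X * X = 1 := pauliReflection_mul_self _
  have hYY : Y * Y = 1 := by
    calc Y * Y = Vᴴ * ((pauliReflection (heavy n k)).1 * ((V * Vᴴ) *
          ((pauliReflection (heavy n k)).1 * V))) := by simp only [hY, Matrix.mul_assoc]
      _ = Vᴴ * (((pauliReflection (heavy n k)).1 * (pauliReflection (heavy n k)).1) * V) := by
          rw [hVV, Matrix.one_mul, Matrix.mul_assoc]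
      _ = 1 := by rw [pauliReflection_mul_self, Matrix.one_mul, hVV']
  have hI : pauliProj (identityString n) = Matrix.vecMulVec Φ (star Φ) := by
    rw [pauliProj, identityString, Finset.sum_singleton, pauliString_I]
  have hΦΦ : star Φ ⬝ᵥ Φ = 1 := by
    have := star_choi_pauliString_dotProduct (fun _ : Fin n => Pauli.I) (pauliString fun _ => .I)
    rw [pauliCoeff_pauliString, if_pos rfl, pauliString_I] at this
    exact this
  have hXv (v : Sys n → ℂ) : X *ᵥ v = v - (2 * (star Φ ⬝ᵥ v)) • Φ := by
    rw [hX, pauliReflection, Matrix.sub_mulVec, Matrix.one_mulVec, Matrix.smul_mulVec, hI,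
      Matrix.vecMulVec_mulVec]
    ext p
    simp
    ring
  have hXΦ : X *ᵥ Φ = -Φ := by
    rw [hXv, hΦΦ]
    module
  have hYΦ : star Φ ⬝ᵥ (Y *ᵥ Φ) = 1 - 2 * ((a ^ 2 : ℝ) : ℂ) := by
    have h1 : V *ᵥ Φ = choi U := kronecker_one_mulVec_choi_one U
    have h2 : star Φ ᵥ* Vᴴ = star (choi U) := by rw [← Matrix.star_mulVec, h1]
    have h3 : star (choi U) ⬝ᵥ choi U = 1 := by
      rw [← h2, ← Matrix.dotProduct_mulVec, ← h1, Matrix.mulVec_mulVec, hVV', Matrix.one_mulVec,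
        hΦΦ]
    have h4 (P : Fin n → Pauli) : star (choi U) ⬝ᵥ choi (pauliString P) = star (pauliCoeff P U) := by
      rw [← star_choi_pauliString_dotProduct, Matrix.star_dotProduct]
    rw [hY, ← Matrix.mulVec_mulVec, ← Matrix.mulVec_mulVec, h1, Matrix.dotProduct_mulVec, h2,
      pauliReflection, Matrix.sub_mulVec, Matrix.one_mulVec, Matrix.smul_mulVec,
      pauliProj_mulVec_choi, dotProduct_sub, h3, dotProduct_smul, dotProduct_sum,
      ← sum_heavy_norm_pauliCoeff_sq]
    simp only [dotProduct_smul, h4, smul_eq_mul]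
    congr 2
    exact Finset.sum_congr rfl fun P _ => mul_comm _ _
  have hG : walk k U = X * Y := rfl
  have hYX : walk k U *ᵥ (Y *ᵥ (X *ᵥ Φ)) = Φ := by
    rw [hG, Matrix.mulVec_mulVec, Matrix.mulVec_mulVec,
      show X * Y * Y * X = X * (Y * Y) * X by simp only [Matrix.mul_assoc], hYY, Matrix.mul_one,
      hXX, Matrix.one_mulVec]
  have hsum : walk k U *ᵥ Φ + Y *ᵥ (X *ᵥ Φ) = ((2 * (2 * a ^ 2 - 1) : ℝ) : ℂ) • Φ := by
    rw [hG, ← Matrix.mulVec_mulVec, hXv, hYΦ, hXΦ, Matrix.mulVec_neg]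
    push_cast
    module
  rw [HasPhaseCos, toLpLin_toLp_eq, toLpLin_toLp_eq, ← WithLp.toLp_add]
  have h5 : walk k U *ᵥ (walk k U *ᵥ Φ) + Φ =
      ((2 * (2 * a ^ 2 - 1) : ℝ) : ℂ) • (walk k U *ᵥ Φ) := by
    nth_rw 2 [← hYX]
    rw [← Matrix.mulVec_add, hsum, Matrix.mulVec_smul]
  rw [h5]
  rfl

/-! ### The algorithm -/

section Workspace

variable {R : Type}

/-- The workspace state with control qubit `1` and joint state `Ψ` of the system and a register with
basis `R`, where `Ψ m` is the unnormalized state of the system at register value `m`. -/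
def embed (Ψ : R → Sys n → ℂ) : Workspace n (Qubits n × R) → ℂ :=
  fun w => if w.1 = 1 then Ψ w.2.2.2 (w.2.1, w.2.2.1) else 0

theorem sum_norm_embed_sq [Fintype R] (Ψ : R → Sys n → ℂ) (p : R → Prop) [DecidablePred p] :
    ∑ w : Workspace n (Qubits n × R) with p w.2.2.2, ‖embed Ψ w‖ ^ 2 =
      ∑ m with p m, ∑ q, ‖Ψ m q‖ ^ 2 := by
  rw [Finset.sum_filter, Finset.sum_filter]
  simp only [Fintype.sum_prod_type, Fin.sum_univ_two, embed]
  simp only [zero_ne_one, if_false, if_true, norm_zero, ne_eq, OfNat.ofNat_ne_zero,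
    not_false_eq_true, zero_pow, ite_self, Finset.sum_const_zero, zero_add]
  rw [Finset.sum_comm' (t' := Finset.univ) (s' := fun _ => Finset.univ) (by simp)]
  have h (x : Qubits n) : ∑ y, ∑ m, (if p m then ‖Ψ m (x, y)‖ ^ 2 else 0) =
      ∑ m, ∑ y, (if p m then ‖Ψ m (x, y)‖ ^ 2 else 0) := Finset.sum_comm
  rw [Finset.sum_comm]
  simp only [h]
  rw [Finset.sum_comm]
  refine Finset.sum_congr rfl fun m _ => ?_
  split_ifs
  · rfl
  · simp

variable [Fintype R] [DecidableEq R]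

theorem controlled_mulVec_embed (U : QMat n) (Ψ : R → Sys n → ℂ) :
    controlled (Qubits n × R) U *ᵥ embed Ψ =
      embed fun m => (U ⊗ₖ (1 : Matrix (Qubits n) (Qubits n) ℂ)) *ᵥ Ψ m := by
  ext ⟨b, x, y, m⟩
  simp only [controlled, Matrix.mulVec, dotProduct, Fintype.sum_prod_type, embed,
    Matrix.add_apply, Matrix.kroneckerMap_apply, Fin.sum_univ_two]
  fin_cases b
  · simp
  · simp [Matrix.one_apply, Prod.ext_iff, ite_and]

/-- Sorting the workspace into the system and the part that controls it. -/
def workspaceEquiv (n : ℕ) (R : Type) :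
    Workspace n (Qubits n × R) ≃ Sys n × (Fin 2 × R) where
  toFun w := ((w.2.1, w.2.2.1), (w.1, w.2.2.2))
  invFun q := (q.2.1, (q.1.1, (q.1.2, q.2.2)))
  left_inv _ := rfl
  right_inv _ := rfl

/-- Apply to the system a unitary selected by the register value. -/
def selectUnitary (F : R → Matrix.unitaryGroup (Sys n) ℂ) :
    Matrix.unitaryGroup (Workspace n (Qubits n × R)) ℂ :=
  ⟨(Matrix.blockDiagonal fun q : Fin 2 × R => (F q.2).1).submatrix
      (workspaceEquiv n R) (workspaceEquiv n R), by
    rw [Matrix.mem_unitaryGroup_iff, Matrix.star_eq_conjTranspose, Matrix.conjTranspose_submatrix,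
      Matrix.submatrix_mul_equiv, Matrix.blockDiagonal_conjTranspose, ← Matrix.blockDiagonal_mul]
    have h (q : Fin 2 × R) : (F q.2).1 * (F q.2).1ᴴ = 1 :=
      Matrix.mem_unitaryGroup_iff.mp (F q.2).2
    simp only [h]
    rw [show (fun _ : Fin 2 × R => (1 : Matrix (Sys n) (Sys n) ℂ)) = 1 from rfl,
      Matrix.blockDiagonal_one, Matrix.submatrix_one_equiv]⟩

theorem selectUnitary_mulVec_embed (F : R → Matrix.unitaryGroup (Sys n) ℂ) (Ψ : R → Sys n → ℂ) :
    (selectUnitary F).1 *ᵥ embed Ψ = embed fun m => (F m).1 *ᵥ Ψ m := by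
  rw [selectUnitary, Matrix.submatrix_mulVec_equiv]
  ext ⟨b, x, y, m⟩
  simp only [Function.comp_apply, Matrix.mulVec, dotProduct, Fintype.sum_prod_type, embed,
    Matrix.blockDiagonal_apply, workspaceEquiv, Equiv.coe_fn_mk, Equiv.coe_fn_symm_mk,
    Fin.sum_univ_two]
  fin_cases b <;> simp [Prod.ext_iff]

/-- Apply the inverse of a unitary to the register. -/
def registerUnitary (n : ℕ) (W : Matrix.unitaryGroup R ℂ) :
    Matrix.unitaryGroup (Workspace n (Qubits n × R)) ℂ :=
  ⟨(1 : Matrix (Fin 2) (Fin 2) ℂ) ⊗ₖ ((1 : Matrix (Qubits n) (Qubits n) ℂ) ⊗ₖ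
      ((1 : Matrix (Qubits n) (Qubits n) ℂ) ⊗ₖ (star W).1)),
    Matrix.kronecker_mem_unitary (one_mem _) (Matrix.kronecker_mem_unitary (one_mem _)
      (Matrix.kronecker_mem_unitary (one_mem _) (star W).2))⟩

theorem registerUnitary_mulVec_embed (W : Matrix.unitaryGroup R ℂ) (Ψ : R → Sys n → ℂ) :
    (registerUnitary n W).1 *ᵥ embed Ψ =
      embed fun j => ∑ m, star ((W : Matrix R R ℂ) m j) • Ψ m := by
  ext ⟨b, x, y, j⟩
  simp only [registerUnitary, Matrix.mulVec, dotProduct, Fintype.sum_prod_type, embed,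
    Matrix.kroneckerMap_apply, Fin.sum_univ_two]
  fin_cases b <;> simp [Matrix.one_apply, Matrix.star_apply]

end Workspace

/-- The tensor power of a unitary. -/
def tensorPower {M : ℕ} (W : Matrix.unitaryGroup (Fin M) ℂ) (r : ℕ) :
    Matrix.unitaryGroup (Fin r → Fin M) ℂ :=
  ⟨Matrix.of fun m j => ∏ i, (W : Matrix _ _ ℂ) (m i) (j i), by
    rw [Matrix.mem_unitaryGroup_iff]
    ext m m'
    simp only [Matrix.mul_apply, Matrix.of_apply, Matrix.star_apply, star_prod,
      ← Finset.prod_mul_distrib]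
    rw [sum_prod_pi (fun i (j : Fin M) => (W : Matrix _ _ ℂ) (m i) j *
      star ((W : Matrix _ _ ℂ) (m' i) j))]
    have hW (a b : Fin M) : ∑ j : Fin M, (W : Matrix _ _ ℂ) a j * star ((W : Matrix _ _ ℂ) b j) =
        if a = b then 1 else 0 := by
      have := congrFun (congrFun (Matrix.mem_unitaryGroup_iff.mp W.2) a) b
      simpa [Matrix.mul_apply, Matrix.one_apply] using this
    simp only [hW, Matrix.one_apply]
    by_cases h : m = m'
    · simp [h]
    · obtain ⟨i, hi⟩ := Function.ne_iff.mp h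
      rw [if_neg h]
      exact Finset.prod_eq_zero (Finset.mem_univ i) (if_neg hi)⟩

/-- The product of the sine windows of `r` registers. -/
def windowProd (M r : ℕ) (m : Fin r → Fin M) : ℝ := ∏ i, sineWindow (M + 1) (m i + 1)

theorem sum_windowProd_sq {M : ℕ} (hM : 1 ≤ M) (r : ℕ) :
    ∑ m : Fin r → Fin M, windowProd M r m ^ 2 = 1 := by
  simp only [windowProd, ← Finset.prod_pow]
  rw [sum_prod_pi (fun _ (a : Fin M) => sineWindow (M + 1) (a + 1) ^ 2)]
  simp [sum_sineWindow_sq M hM]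

theorem sum_norm_choi_one_sq (n : ℕ) : ∑ q, ‖choi (1 : QMat n) q‖ ^ 2 = 1 := by
  have h : frobNorm (1 : QMat n) ^ 2 = 1 := by
    rw [← sum_norm_pauliCoeff_sq, ← pauliString_I]
    simp [pauliCoeff_pauliString, apply_ite norm, ite_pow]
  rw [frobNorm_sq] at h
  rw [← h, Fintype.sum_prod_type, Finset.sum_div]
  refine Finset.sum_congr rfl fun x _ => ?_
  rw [Finset.sum_div]
  refine Finset.sum_congr rfl fun y _ => ?_
  rw [choi, norm_div, div_pow, Complex.norm_real, Real.norm_eq_abs, sq_abs,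
    Real.sq_sqrt (by positivity)]

/-- The sum of the register values: the power of the walk that they control. -/
def totalPower {M r : ℕ} (m : Fin r → Fin M) : ℕ := ∑ i, (m i : ℕ)

theorem totalPower_le {M r : ℕ} (m : Fin r → Fin M) : totalPower m ≤ r * M := by
  refine (Finset.sum_le_card_nsmul _ _ M fun i _ => (m i).2.le).trans ?_
  simp

/-- The two queries that apply the walk once to the register values with `l < totalPower m`; at the
other values both fixed unitaries are the identity, and the two evolutions cancel. -/
def walkSteps (n k M r : ℕ) (t : ℝ) (ht : 0 ≤ t) (l : ℕ) :
    List (Query × Matrix.unitaryGroup (Workspace n (Qubits n × (Fin r → Fin M))) ℂ) :=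
  [(⟨t, ht, false⟩, selectUnitary fun m => if l < totalPower m then pauliReflection (heavy n k) else 1),
   (⟨t, ht, true⟩, selectUnitary fun m =>
      if l < totalPower m then pauliReflection (identityString n) else 1)]

/-- Amplitude estimation of the heavy part of the evolution for time `t`, with `r` registers of
dimension `M`, accepting when at least half of the estimates of `2a² - 1` lie below `τ`. The control
qubit of the queries stays in the state `1`. The last query, for time zero, only serves to carry the
final change of basis. -/
def amplitudeTester (n k M r : ℕ) (hM : 1 ≤ M) (t : ℝ) (ht : 0 ≤ t) (τ : ℝ) :
    NonadaptiveAlgorithm n where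
  Anc := Qubits n × (Fin r → Fin M)
  init := embed fun m => (windowProd M r m : ℂ) • choi 1
  init_unit := by
    have h := sum_norm_embed_sq (fun m : Fin r → Fin M => (windowProd M r m : ℂ) • choi (1 : QMat n))
      (fun _ => True)
    simp only [Finset.filter_true] at h
    rw [h]
    simp only [Pi.smul_apply, smul_eq_mul, norm_mul, mul_pow, Complex.norm_real, Real.norm_eq_abs,
      sq_abs, ← Finset.mul_sum, sum_norm_choi_one_sq, mul_one, sum_windowProd_sq hM]
  steps := (List.range (r * M)).flatMap (walkSteps n k M r t ht) ++
    [(⟨0, le_rfl, false⟩, registerUnitary n (tensorPower (pathUnitary M) r))]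
  accept := Finset.univ.filter fun w => r ≤ 2 * numBelow M r τ w.2.2.2

/-- The effect of a query and the unitary after it. -/
def applyStep {Anc : Type} [Fintype Anc] [DecidableEq Anc] (H : QMat n)
    (ψ : Workspace n Anc → ℂ) (s : Query × Matrix.unitaryGroup (Workspace n Anc) ℂ) :
    Workspace n Anc → ℂ :=
  (s.2 : Matrix (Workspace n Anc) (Workspace n Anc) ℂ) *ᵥ
    (controlled Anc (s.1.evolution H) *ᵥ ψ)

theorem foldl_walkSteps {k M r : ℕ} {t : ℝ} (ht : 0 ≤ t) {H : QMat n} (hH : H.IsHermitian)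
    (Ψ : (Fin r → Fin M) → Sys n → ℂ) (L : ℕ) :
    ((List.range L).flatMap (walkSteps n k M r t ht)).foldl (applyStep H) (embed Ψ) =
      embed fun m => (walk k (Query.evolution ⟨t, ht, false⟩ H) ^ min L (totalPower m)) *ᵥ Ψ m := by
  induction L with
  | zero => simp
  | succ L ih =>
    rw [List.range_succ, List.flatMap_append, List.foldl_append, ih]
    simp only [List.flatMap_singleton, walkSteps, List.foldl_cons, List.foldl_nil, applyStep]
    rw [controlled_mulVec_embed, selectUnitary_mulVec_embed, controlled_mulVec_embed,
      selectUnitary_mulVec_embed, Query.evolution_reverse t ht hH]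
    set U := Query.evolution ⟨t, ht, false⟩ H with hU
    have hV := Matrix.mem_unitaryGroup_iff'.mp
      (kronecker_one_mem_unitaryGroup (Query.evolution_mem_unitaryGroup t ht hH))
    rw [← hU, Matrix.star_eq_conjTranspose] at hV
    have hc : Uᴴ ⊗ₖ (1 : Matrix (Qubits n) (Qubits n) ℂ) =
        (U ⊗ₖ (1 : Matrix (Qubits n) (Qubits n) ℂ))ᴴ := by
      rw [Matrix.conjTranspose_kronecker, Matrix.conjTranspose_one]
    congr 1
    ext1 m
    rw [hc]
    by_cases hm : L < totalPower m
    · simp only [if_pos hm]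
      rw [min_eq_left hm.le, min_eq_left (Nat.succ_le_of_lt hm), pow_succ']
      simp only [Matrix.mulVec_mulVec, walk, Matrix.mul_assoc]
    · simp only [if_neg hm]
      rw [min_eq_right (by omega), min_eq_right (by omega)]
      simp only [Matrix.UnitaryGroup.one_val, Matrix.one_mulVec]
      rw [Matrix.mulVec_mulVec, hV, Matrix.one_mulVec]

theorem finalState_amplitudeTester {k M r : ℕ} (hM : 1 ≤ M) {t : ℝ} (ht : 0 ≤ t) (τ : ℝ)
    {H : QMat n} (hH : H.IsHermitian) :
    (amplitudeTester n k M r hM t ht τ).finalState H = embed fun j =>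
      (registerAmp (Matrix.toLpLin 2 2 (walk k (Query.evolution ⟨t, ht, false⟩ H))) M r j
        (WithLp.toLp 2 (choi 1))).ofLp := by
  have h0 : Query.evolution ⟨0, le_rfl, false⟩ H = 1 := by simp [Query.evolution]
  have hfold : (amplitudeTester n k M r hM t ht τ).finalState H =
      List.foldl (applyStep H) (embed fun m => (windowProd M r m : ℂ) • choi 1)
        ((List.range (r * M)).flatMap (walkSteps n k M r t ht) ++
          [(⟨0, le_rfl, false⟩, registerUnitary n (tensorPower (pathUnitary M) r))]) := rfl
  rw [hfold, List.foldl_append, foldl_walkSteps ht hH]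
  simp only [List.foldl_cons, List.foldl_nil, applyStep, h0]
  rw [controlled_mulVec_embed, Matrix.one_kronecker_one]
  simp only [Matrix.one_mulVec]
  rw [registerUnitary_mulVec_embed]
  congr 1
  ext1 j
  rw [registerAmp, WithLp.ofLp_sum]
  refine Finset.sum_congr rfl fun m _ => ?_
  rw [min_eq_right (totalPower_le m), Matrix.mulVec_smul, toLpLin_pow_toLp, smul_smul,
    WithLp.ofLp_smul]
  congr 1
  simp only [phaseWeight, Finset.prod_mul_distrib, tensorPower, Matrix.of_apply, star_prod,
    windowProd, Complex.ofReal_prod]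

theorem sum_norm_registerAmp_sq {k M r : ℕ} (hM : 1 ≤ M) {U : QMat n}
    (hU : U ∈ Matrix.unitaryGroup (Qubits n) ℂ) (Φ : EuclideanSpace ℂ (Sys n)) :
    ∑ j, ‖registerAmp (Matrix.toLpLin 2 2 (walk k U)) M r j Φ‖ ^ 2 = ‖Φ‖ ^ 2 := by
  have hG := norm_toLpLin_of_mem_unitaryGroup (walk_mem_unitaryGroup k hU)
  have h (j : Fin r → Fin M) : registerAmp (Matrix.toLpLin 2 2 (walk k U)) M r j Φ =
      ∑ m, star ((tensorPower (pathUnitary M) r : Matrix _ _ ℂ) m j) • ((windowProd M r m : ℂ) •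
        ((Matrix.toLpLin 2 2 (walk k U)) ^ totalPower m) Φ) := by
    refine Finset.sum_congr rfl fun m _ => ?_
    rw [smul_smul]
    congr 1
    simp only [phaseWeight, Finset.prod_mul_distrib, tensorPower, Matrix.of_apply, star_prod,
      windowProd, Complex.ofReal_prod]
  simp only [h]
  rw [sum_norm_sum_star_unitary_smul_sq]
  simp only [norm_smul, norm_pow_apply hG, mul_pow, Complex.norm_real, Real.norm_eq_abs, sq_abs]
  rw [← Finset.sum_mul, sum_windowProd_sq hM, one_mul]

/-! ### Correctness and cost -/

theorem acceptProb_amplitudeTester {k M r : ℕ} (hM : 1 ≤ M) {t : ℝ} (ht : 0 ≤ t) (τ : ℝ)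
    {H : QMat n} (hH : H.IsHermitian) :
    (amplitudeTester n k M r hM t ht τ).acceptProb H = ∑ j with r ≤ 2 * numBelow M r τ j,
      ‖registerAmp (Matrix.toLpLin 2 2 (walk k (Query.evolution ⟨t, ht, false⟩ H))) M r j
        (WithLp.toLp 2 (choi 1))‖ ^ 2 := by
  rw [NonadaptiveAlgorithm.acceptProb, finalState_amplitudeTester hM ht τ hH]
  refine (sum_norm_embed_sq _ fun j => r ≤ 2 * numBelow M r τ j).trans ?_
  simp only [EuclideanSpace.norm_sq_eq]

theorem rejectProb_amplitudeTester {k M r : ℕ} (hM : 1 ≤ M) {t : ℝ} (ht : 0 ≤ t) (τ : ℝ)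
    {H : QMat n} (hH : H.IsHermitian) :
    (amplitudeTester n k M r hM t ht τ).rejectProb H = ∑ j with ¬ r ≤ 2 * numBelow M r τ j,
      ‖registerAmp (Matrix.toLpLin 2 2 (walk k (Query.evolution ⟨t, ht, false⟩ H))) M r j
        (WithLp.toLp 2 (choi 1))‖ ^ 2 := by
  rw [NonadaptiveAlgorithm.rejectProb, finalState_amplitudeTester hM ht τ hH]
  have hc : (amplitudeTester n k M r hM t ht τ).acceptᶜ = Finset.univ.filter
      fun w : Workspace n (Qubits n × (Fin r → Fin M)) => ¬ r ≤ 2 * numBelow M r τ w.2.2.2 := by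
    rw [← Finset.compl_filter]
    rfl
  rw [hc]
  refine (sum_norm_embed_sq _ fun j => ¬ r ≤ 2 * numBelow M r τ j).trans ?_
  simp only [EuclideanSpace.norm_sq_eq]

theorem norm_toLp_choi_one_sq (n : ℕ) : ‖WithLp.toLp 2 (choi (1 : QMat n))‖ ^ 2 = 1 := by
  rw [EuclideanSpace.norm_sq_eq, sum_norm_choi_one_sq]

theorem acceptProb_add_rejectProb_amplitudeTester {k M r : ℕ} (hM : 1 ≤ M) {t : ℝ} (ht : 0 ≤ t)
    (τ : ℝ) {H : QMat n} (hH : H.IsHermitian) :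
    (amplitudeTester n k M r hM t ht τ).acceptProb H +
      (amplitudeTester n k M r hM t ht τ).rejectProb H = 1 := by
  rw [acceptProb_amplitudeTester hM ht τ hH, rejectProb_amplitudeTester hM ht τ hH,
    Finset.sum_filter_add_sum_filter_not,
    sum_norm_registerAmp_sq hM (Query.evolution_mem_unitaryGroup t ht hH), norm_toLp_choi_one_sq]

/-- With registers of dimension about `32 / g`, the mean squared error of phase estimation is at
most a sixteenth of the squared separation `g b` from the threshold, where `g` is the gap between
the amplitudes. Both scale with the amplitude, since the sine of the phase is at most `2a`. -/
theorem sixteen_mul_error_le {N g a b γ : ℝ} (hN : 0 < N) (hg : 0 < g) (hgN : 32 ≤ g * N)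
    (ha : 0 ≤ a) (hab : a ≤ b) (hgb : g ≤ b) (hγ : g * b ≤ γ) :
    16 * ((1 - Real.cos (Real.pi / N)) ^ 2 +
      Real.sin (Real.pi / N) ^ 2 * (1 - (2 * a ^ 2 - 1) ^ 2)) ≤ γ ^ 2 := by
  set u := 1 / N with hu
  have hu0 : 0 < u := by positivity
  have hug : u ≤ g / 32 := by
    rw [hu, div_le_iff₀ hN]
    linarith
  have hpi : Real.pi ^ 2 ≤ 10 := by nlinarith [Real.pi_lt_d2, Real.pi_pos]
  have hsq : (Real.pi / N) ^ 2 ≤ 10 * u ^ 2 := by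
    rw [div_eq_mul_one_div, ← hu, mul_pow]
    gcongr
  have hcos : 1 - Real.cos (Real.pi / N) ≤ 5 * u ^ 2 := by
    linarith [Real.one_sub_sq_div_two_le_cos (x := Real.pi / N)]
  have hcos0 : 0 ≤ 1 - Real.cos (Real.pi / N) := by linarith [Real.cos_le_one (Real.pi / N)]
  have hsin : Real.sin (Real.pi / N) ^ 2 ≤ 10 * u ^ 2 := Real.sin_sq_le_sq.trans hsq
  have hb : 0 < b := hg.trans_le hgb
  have hlam : 1 - (2 * a ^ 2 - 1) ^ 2 ≤ 4 * b ^ 2 := by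
    have h1 : a ^ 2 ≤ b ^ 2 := pow_le_pow_left₀ ha hab 2
    nlinarith [sq_nonneg (a ^ 2)]
  have h1 : (1 - Real.cos (Real.pi / N)) ^ 2 ≤ (5 * u ^ 2) ^ 2 := pow_le_pow_left₀ hcos0 hcos 2
  have h2 : Real.sin (Real.pi / N) ^ 2 * (1 - (2 * a ^ 2 - 1) ^ 2) ≤
      10 * u ^ 2 * (4 * b ^ 2) :=
    (mul_le_mul_of_nonneg_left hlam (sq_nonneg _)).trans
      (mul_le_mul_of_nonneg_right hsin (by positivity))
  have h3 : u ^ 2 ≤ g ^ 2 / 1024 := by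
    refine (pow_le_pow_left₀ hu0.le hug 2).trans (le_of_eq ?_)
    ring
  have h4 : u ^ 2 ≤ b ^ 2 / 1024 :=
    h3.trans (div_le_div_of_nonneg_right (pow_le_pow_left₀ hg.le hgb 2) (by norm_num))
  have h5 : u ^ 2 * u ^ 2 ≤ g ^ 2 / 1024 * (b ^ 2 / 1024) :=
    mul_le_mul h3 h4 (by positivity) (by positivity)
  have h6 : u ^ 2 * b ^ 2 ≤ g ^ 2 / 1024 * b ^ 2 := mul_le_mul_of_nonneg_right h3 (sq_nonneg b)
  have h7 : (g * b) ^ 2 ≤ γ ^ 2 := pow_le_pow_left₀ (by positivity) hγ 2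
  have h8 : 0 < g ^ 2 * b ^ 2 := by positivity
  nlinarith

/-- Amplitude estimation decides between `a ≤ a₁` and `a₂ ≤ a`, where `a` is the norm of the
heavy part of the evolution, with error probability at most `2^{-r}`. -/
theorem amplitudeTester_correct {k M r : ℕ} (hM : 1 ≤ M) {t : ℝ} (ht : 0 ≤ t) {a₁ a₂ : ℝ}
    (ha₁ : 0 ≤ a₁) (ha : a₁ < a₂) (hMa : 32 ≤ (a₂ - a₁) * ((M + 1 : ℕ) : ℝ)) {H : QMat n}
    (hH : H.IsHermitian) :
    (‖highWeight k (Query.evolution ⟨t, ht, false⟩ H)‖ ≤ a₁ → 1 - (1 / 2) ^ r ≤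
      (amplitudeTester n k M r hM t ht (a₁ ^ 2 + a₂ ^ 2 - 1)).acceptProb H) ∧
    (a₂ ≤ ‖highWeight k (Query.evolution ⟨t, ht, false⟩ H)‖ → 1 - (1 / 2) ^ r ≤
      (amplitudeTester n k M r hM t ht (a₁ ^ 2 + a₂ ^ 2 - 1)).rejectProb H) := by
  set τ := a₁ ^ 2 + a₂ ^ 2 - 1 with hτ
  set U := Query.evolution ⟨t, ht, false⟩ H with hU
  have hUu : U ∈ Matrix.unitaryGroup (Qubits n) ℂ := Query.evolution_mem_unitaryGroup t ht hH
  set a := ‖highWeight k U‖ with ha_def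
  have ha0 : 0 ≤ a := norm_nonneg _
  have hsum := acceptProb_add_rejectProb_amplitudeTester (k := k) (r := r) hM ht τ hH
  have hG := norm_toLpLin_of_mem_unitaryGroup (walk_mem_unitaryGroup k hUu)
  have hphase := hasPhaseCos_walk k hUu
  have hN : (0 : ℝ) < ((M + 1 : ℕ) : ℝ) := by positivity
  have hg : 0 < a₂ - a₁ := sub_pos.mpr ha
  constructor
  · intro hle
    have hγ : (a₂ - a₁) * a₂ ≤ a₁ ^ 2 + a₂ ^ 2 - 2 * a ^ 2 := by
      nlinarith [pow_le_pow_left₀ ha0 hle 2]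
    have herr := sixteen_mul_error_le hN hg hMa ha0 (hle.trans ha.le) (by linarith) hγ
    have hγ0 : 0 < a₁ ^ 2 + a₂ ^ 2 - 2 * a ^ 2 :=
      (mul_pos hg (ha₁.trans_lt ha)).trans_le hγ
    have hfail := hphase.sum_norm_registerAmp_sq_le hG hM hγ0 herr
      (fun j => ¬ pathEigenvalue M j < τ) (fun j hj => by
        refine le_trans ?_ (le_abs_self _)
        linarith [not_lt.mp hj]) r (Finset.univ.filter fun j => ¬ r ≤ 2 * numBelow M r τ j)
      (fun f hf => by
        have h1 := (Finset.mem_filter.mp hf).2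
        have h2 := Finset.card_filter_add_card_filter_not (s := (Finset.univ : Finset (Fin r)))
          (fun i => pathEigenvalue M (f i) < τ)
        rw [Finset.card_univ, Fintype.card_fin] at h2
        unfold numBelow at h1
        omega)
    rw [← rejectProb_amplitudeTester hM ht τ hH, norm_toLp_choi_one_sq, mul_one] at hfail
    linarith
  · intro hle
    have hγ : (a₂ - a₁) * a ≤ 2 * a ^ 2 - a₁ ^ 2 - a₂ ^ 2 := by
      nlinarith [mul_nonneg ha₁ (sub_nonneg.mpr (ha.le.trans hle)),
        mul_nonneg ha0 (sub_nonneg.mpr hle), mul_nonneg (ha₁.trans ha.le) (sub_nonneg.mpr hle)]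
    have herr := sixteen_mul_error_le hN hg hMa ha0 le_rfl (by linarith) hγ
    have hγ0 : 0 < 2 * a ^ 2 - a₁ ^ 2 - a₂ ^ 2 :=
      (mul_pos hg ((ha₁.trans_lt ha).trans_le hle)).trans_le hγ
    have hfail := hphase.sum_norm_registerAmp_sq_le hG hM hγ0 herr
      (fun j => pathEigenvalue M j < τ) (fun j hj => by
        refine le_trans ?_ (neg_le_abs _)
        linarith) r (Finset.univ.filter fun j => r ≤ 2 * numBelow M r τ j)
      (fun f hf => (Finset.mem_filter.mp hf).2)
    rw [← acceptProb_amplitudeTester hM ht τ hH, norm_toLp_choi_one_sq, mul_one] at hfail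
    linarith

theorem numQueries_amplitudeTester {k M r : ℕ} (hM : 1 ≤ M) {t : ℝ} (ht : 0 ≤ t) (τ : ℝ) :
    (amplitudeTester n k M r hM t ht τ).numQueries = 2 * (r * M) + 1 := by
  change ((List.range (r * M)).flatMap (walkSteps n k M r t ht) ++ [_]).length = _
  rw [List.length_append, List.length_flatMap]
  simp [walkSteps, mul_comm]

theorem totalTime_amplitudeTester {k M r : ℕ} (hM : 1 ≤ M) {t : ℝ} (ht : 0 ≤ t) (τ : ℝ) :
    (amplitudeTester n k M r hM t ht τ).totalTime = 2 * (r * M) * t := by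
  have h (L : ℕ) : (((List.range L).flatMap (walkSteps n k M r t ht)).map
      fun s => s.1.time).sum = 2 * L * t := by
    induction L with
    | zero => simp
    | succ L ih =>
      rw [List.range_succ, List.flatMap_append, List.map_append, List.sum_append, ih]
      simp [walkSteps]
      ring
  have hsum : (amplitudeTester n k M r hM t ht τ).totalTime =
      (((List.range (r * M)).flatMap (walkSteps n k M r t ht) ++
        [((⟨0, le_rfl, false⟩ : Query), registerUnitary n (tensorPower (pathUnitary M) r))]).map
          fun s => s.1.time).sum := rfl
  rw [hsum, List.map_append, List.sum_append, h]
  simp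

/-- The algorithm that flips a fair coin without making any query. -/
def coinFlip (n : ℕ) : NonadaptiveAlgorithm n where
  Anc := Unit
  init := fun w => if w.2 = (fun _ => 0, ()) then ((√2)⁻¹ : ℝ) else 0
  init_unit := by
    rw [Fintype.sum_prod_type]
    simp [apply_ite norm, ite_pow]
  steps := []
  accept := Finset.univ.filter fun w => w.1 = 0

theorem coinFlip_probs (n : ℕ) (H : QMat n) :
    (coinFlip n).acceptProb H = 1 / 2 ∧ (coinFlip n).rejectProb H = 1 / 2 := by
  have hac : (coinFlip n).acceptProb H = ∑ w : Workspace n Unit with w.1 = 0,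
      ‖if w.2 = (fun _ => 0, ()) then (((√2)⁻¹ : ℝ) : ℂ) else 0‖ ^ 2 := rfl
  have hre : (coinFlip n).rejectProb H = ∑ w ∈ (Finset.univ.filter
      fun w : Workspace n Unit => w.1 = 0)ᶜ,
      ‖if w.2 = (fun _ => 0, ()) then (((√2)⁻¹ : ℝ) : ℂ) else 0‖ ^ 2 := rfl
  rw [hac, hre, Finset.compl_filter, Finset.sum_filter, Finset.sum_filter,
    Fintype.sum_prod_type, Fintype.sum_prod_type]
  constructor <;> simp [apply_ite norm, ite_pow]

theorem half_pow_le_of_two_mul_log_le {δ : ℝ} (hδ : 0 < δ) (hδ1 : δ < 1) {r : ℕ}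
    (hr : 2 * Real.log (1 / δ) ≤ r) : (1 / 2 : ℝ) ^ r ≤ δ := by
  rw [← Real.log_le_log_iff (by positivity) hδ, Real.log_pow]
  rw [one_div, Real.log_inv] at hr ⊢
  have h2 : 1 / 2 ≤ Real.log 2 := by linarith [Real.log_two_gt_d9]
  have h3 : Real.log δ < 0 := Real.log_neg hδ hδ1
  nlinarith

theorem exists_isTolerantLocalityTester (n k : ℕ) {ε₁ ε₂ δ : ℝ} (hε₁ : 0 ≤ ε₁) (hε : ε₁ < ε₂)
    (hε₂ : ε₂ ≤ 1) (hδ0 : 0 < δ) (hδ1 : δ < 1) :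
    ∃ T : NonadaptiveAlgorithm n, T.IsTolerantLocalityTester k ε₁ ε₂ δ ∧
      (T.numQueries : ℝ) ≤ 2058 * (Real.log (1 / δ) / (ε₂ - ε₁) ^ 2) ∧
      T.totalTime ≤ 2058 * (Real.log (1 / δ) / (ε₂ - ε₁)) := by
  have hL0 : 0 < Real.log (1 / δ) := Real.log_pos (by rw [lt_div_iff₀ hδ0]; linarith)
  have hΔ0 : 0 < ε₂ - ε₁ := sub_pos.mpr hε
  rcases le_or_gt (1 / 2) δ with hδ | hδ
  · -- The bound on the number of queries tends to zero as `δ → 1`, but a coin flip is enough here.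
    refine ⟨coinFlip n, fun H _ _ => ⟨fun _ => ?_, fun _ => ?_⟩, ?_, ?_⟩
    · rw [(coinFlip_probs n H).1]
      linarith
    · rw [(coinFlip_probs n H).2]
      linarith
    · have : (coinFlip n).numQueries = 0 := rfl
      rw [this, Nat.cast_zero]
      positivity
    · have : (coinFlip n).totalTime = 0 := rfl
      rw [this]
      positivity
  · set Δ := ε₂ - ε₁ with hΔ
    set L := Real.log (1 / δ) with hL
    have hΔ1 : Δ ≤ 1 := by linarith
    have hL1 : 1 / 2 ≤ L := by
      have h1 : Real.log 2 ≤ L := Real.log_le_log (by norm_num) (by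
        rw [le_div_iff₀ hδ0]
        linarith)
      linarith [Real.log_two_gt_d9]
    -- At time `Δ / 4` the second-order error `t²` of the amplitudes `t ε₁` and `t ε₂` leaves a gap
    -- of `Δ² / 8` between them.
    set t := Δ / 4 with ht
    have ht0 : 0 ≤ t := by positivity
    set a₁ := t * ε₁ + t ^ 2 with ha₁
    set a₂ := t * ε₂ - t ^ 2 with ha₂
    have hgap : a₂ - a₁ = Δ ^ 2 / 8 := by
      rw [ha₁, ha₂, ht, hΔ]
      ring
    have hlt : a₁ < a₂ := by
      have : 0 < Δ ^ 2 / 8 := by positivity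
      linarith
    set M := ⌈256 / Δ ^ 2⌉₊ with hMdef
    have hMge : 256 / Δ ^ 2 ≤ M := Nat.le_ceil _
    have hM : 1 ≤ M := Nat.one_le_ceil_iff.mpr (by positivity)
    have hΔsq : 1 ≤ 1 / Δ ^ 2 := by
      rw [le_div_iff₀ (by positivity), one_mul]
      exact pow_le_one₀ hΔ0.le hΔ1
    have hMle : (M : ℝ) ≤ 257 * (1 / Δ ^ 2) := by
      have := Nat.ceil_lt_add_one (a := 256 / Δ ^ 2) (by positivity)
      have h2 : 256 / Δ ^ 2 = 256 * (1 / Δ ^ 2) := by ring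
      linarith
    set r := ⌈2 * L⌉₊ with hrdef
    have hrge : 2 * L ≤ r := Nat.le_ceil _
    have hrle : (r : ℝ) ≤ 4 * L := by
      have := Nat.ceil_lt_add_one (a := 2 * L) (by positivity)
      linarith
    have hrM : (r : ℝ) * M ≤ 1028 * (L / Δ ^ 2) := by
      calc (r : ℝ) * M ≤ 4 * L * (257 * (1 / Δ ^ 2)) :=
            mul_le_mul hrle hMle (by positivity) (by positivity)
        _ = 1028 * (L / Δ ^ 2) := by ring
    have hpow := half_pow_le_of_two_mul_log_le hδ0 hδ1 hrge
    refine ⟨amplitudeTester n k M r hM t ht0 (a₁ ^ 2 + a₂ ^ 2 - 1), fun H hH hH1 => ?_, ?_, ?_⟩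
    · have hMa : 32 ≤ (a₂ - a₁) * ((M + 1 : ℕ) : ℝ) := by
        rw [div_le_iff₀ (by positivity)] at hMge
        rw [hgap]
        push_cast
        nlinarith [sq_nonneg Δ]
      obtain ⟨hacc, hrej⟩ := amplitudeTester_correct (k := k) (r := r) hM ht0 (by positivity) hlt
        hMa hH
      have hamp := abs_le.mp (abs_norm_highWeight_exp_sub_le k hH1 ht0 (by linarith))
      have hev : Query.evolution ⟨t, ht0, false⟩ H =
          NormedSpace.exp ((-Complex.I * (t : ℂ)) • H) := by simp [Query.evolution]
      rw [hev] at hacc hrej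
      refine ⟨fun hclose => ?_, fun hfar => ?_⟩
      · have h1 := mul_le_mul_of_nonneg_left (norm_highWeight_le_of_close hclose) ht0
        exact le_trans (by linarith) (hacc (by linarith [hamp.2]))
      · have h1 := mul_le_mul_of_nonneg_left (le_norm_highWeight_of_far hH hfar) ht0
        exact le_trans (by linarith) (hrej (by linarith [hamp.1]))
    · rw [numQueries_amplitudeTester]
      push_cast
      have h1 : L ≤ L / Δ ^ 2 := by
        have := mul_le_mul_of_nonneg_left hΔsq hL0.le
        rwa [mul_one, mul_one_div] at this
      linarith
    · rw [totalTime_amplitudeTester]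
      calc 2 * ((r : ℝ) * M) * t ≤ 2 * (1028 * (L / Δ ^ 2)) * t := by gcongr
        _ = 514 * (L / Δ) := by
          rw [ht]
          field_simp
          ring
        _ ≤ 2058 * (L / Δ) := by
          gcongr
          norm_num

end

end LocalityTesting

theorem theorem3 :
    ∃ C : ℝ, 0 < C ∧
      ∀ (n k : ℕ) (ε₁ ε₂ δ : ℝ), 0 ≤ ε₁ → ε₁ < ε₂ → ε₂ ≤ 1 → 0 < δ → δ < 1 →
        ∃ T : LocalityTesting.NonadaptiveAlgorithm n,
          T.IsTolerantLocalityTester k ε₁ ε₂ δ ∧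
          (T.numQueries : ℝ) ≤ C * (Real.log (1 / δ) / (ε₂ - ε₁) ^ 2) ∧
          T.totalTime ≤ C * (Real.log (1 / δ) / (ε₂ - ε₁)) := by
  exact ⟨2058, by norm_num, fun n k _ _ _ hε₁ hε hε₂ hδ0 hδ1 =>
    LocalityTesting.exists_isTolerantLocalityTester n k hε₁ hε hε₂ hδ0 hδ1⟩
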